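/- A $k$-strategy network coordination game is given by a finite undirected game graph $G=(V,E)$ with $n=|V|$ players, each having strategy set $[k]$, and for each edge $uv\in E$ a payoff matrix $A_{uv}\in[-1,1]^{k\times k}$ (with $A_{vu}=A_{uv}^{\mathsf T}$). At a strategy profile $\sigma\in[k]^V$ player $u$ receives $\mathrm{payoff}_u(\sigma)=\sum_{v:\,uv\in E}A_{uv}(\sigma_u,\sigma_v)$. A pure Nash equilibrium (PNE) is a profile at which no player can increase her payoff by changing only her own strategy. An execution of better-response dynamics starts at some profile and, as long as the current profile is not a PNE, lets some player switch to a strategy that strictly increases her own payoff (player and improving strategy are chosen arbitrarily); it stops at a PNE. In a smoothed instance with parameter $\phi$, the $|E|k^2$ payoff entries are independent random variables supported on $[-1,1]$, each with density at most $\phi$. For a draw $A$ of the payoffs, let $T(A)$ be the maximum number of steps of an execution of better-response dynamics until it reaches a PNE, over all initial profiles and all choices of improving moves. **Theorem.** There is an absolute constant $C$ such that for every game graph $G$ on $n$ players, every $k$ and $\phi$, and every smoothed instance on $G$ with parameter $\phi$, $$\mathbb E[T(A)]\le C\,\phi\,(nk)^{C k\log(nk)}\qquad\text{and}\qquad \mathbb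 E[T(A)]\le C\,\bigl(n^{k\log(nk)}\,\phi\bigr)^{C},$$ that is, the expected number of steps is $O(\phi)\cdot(nk)^{O(k\log(nk))}$ and is polynomial in $(n^{k\log(nk)},\phi)$. If moreover $G$ is the complete graph, then $$\mathbb E[T(A)]\le (nk\phi)^{Ck}\qquad\text{and}\qquad \mathbb E[T(A)]\le C\,\bigl(n^{k}\phi\bigr)^{C},$$ that is, the expected number of steps is $(nk\phi)^{O(k)}$ and is polynomial in $(n^k,\phi)$. -/

import Mathlib

open MeasureTheory ProbabilityTheory
open scoped ENNReal NNReal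

namespace NetCoord

/-- Index set of the payoff vector of a `k`-strategy network coordination game on the game graph `G`:
unordered pairs `{(u, i), (v, j)}` with `uv` an edge of `G` and `i, j` strategies (so there are
`|E| * k ^ 2` of them). The entry at `{(u, i), (v, j)}` is the common payoff `A_{uv}(i, j)` of `u` and
`v` on the edge `uv` when `u` plays `i` and `v` plays `j`. -/
abbrev PayoffIndex {V : Type*} (G : SimpleGraph V) (k : ℕ) : Type _ :=
  (G.comap (Prod.fst : V × Fin k → V)).edgeSet

/-- Strategy profiles. -/
abbrev Profile (V : Type*) (k : ℕ) : Type _ := V → Fin k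

section Game

variable {V : Type*} [Fintype V] [DecidableEq V] {G : SimpleGraph V} [DecidableRel G.Adj] {k : ℕ}

/-- The payoff of player `u`: the sum over all neighbours `v` of `A_{uv}(σ_u, σ_v)`. -/
def payoff (A : PayoffIndex G k → ℝ) (u : V) (σ : Profile V k) : ℝ :=
  ∑ v : G.neighborSet u, A ⟨s((u, σ u), (v.1, σ v.1)), v.2⟩

/-- Pure Nash equilibrium: no player gains by a unilateral deviation. -/
def IsPNE (A : PayoffIndex G k → ℝ) (σ : Profile V k) : Prop :=
  ∀ (u : V) (i : Fin k), payoff A u (Function.update σ u i) ≤ payoff A u σ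

/-- `τ` arises from `σ` by one better-response move: a single player changes strategy and strictly
improves her own payoff. -/
def IsBetterResponse (A : PayoffIndex G k → ℝ) (σ τ : Profile V k) : Prop :=
  ∃ (u : V) (i : Fin k), τ = Function.update σ u i ∧ payoff A u σ < payoff A u τ

/-- An execution of better-response dynamics from `σ₀`, with improvements chosen arbitrarily: as long
as the current profile is not a pure Nash equilibrium, some better-response move is made; at a pure
Nash equilibrium the dynamics has stopped. -/
structure IsExecution (A : PayoffIndex G k → ℝ) (σ₀ : Profile V k) (s : ℕ → Profile V k) : Prop where
  start : s 0 = σ₀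
  move : ∀ t, ¬ IsPNE A (s t) → IsBetterResponse A (s t) (s (t + 1))
  halt : ∀ t, IsPNE A (s t) → s (t + 1) = s t

/-- The number of steps until an execution reaches a pure Nash equilibrium (`⊤` if it never does). -/
noncomputable def stepsToPNE (A : PayoffIndex G k → ℝ) (s : ℕ → Profile V k) : ℕ∞ :=
  ⨅ (t : ℕ) (_ : IsPNE A (s t)), (t : ℕ∞)

/-- The largest number of steps of any execution of better-response dynamics from `σ₀`. -/
noncomputable def brTime (A : PayoffIndex G k → ℝ) (σ₀ : Profile V k) : ℕ∞ :=
  ⨆ (s : ℕ → Profile V k) (_ : IsExecution A σ₀ s), stepsToPNE A s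

/-- The expected number of steps of better-response dynamics on random payoffs, when both the initial
profile and the improving moves are chosen by an adversary who may know the drawn payoffs. -/
noncomputable def expectedBRTime {Ω : Type*} [MeasurableSpace Ω] (P : Measure Ω)
    (A : PayoffIndex G k → Ω → ℝ) : ℝ≥0∞ :=
  ∫⁻ ω, ⨆ σ₀ : Profile V k, (brTime (fun e => A e ω) σ₀ : ℝ≥0∞) ∂P

end Game

/-- Smoothed payoffs: the entries of the payoff vector are independent random variables supported on
`[-1, 1]`, each with a density (with respect to Lebesgue measure) bounded by `φ`. -/
structure IsSmoothed {V : Type*} {G : SimpleGraph V} {k : ℕ} {Ω : Type*} [MeasurableSpace Ω]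
    (P : Measure Ω) (φ : ℝ≥0) (A : PayoffIndex G k → Ω → ℝ) : Prop where
  indep : iIndepFun A P
  mem_Icc : ∀ e, ∀ᵐ ω ∂P, A e ω ∈ Set.Icc (-1 : ℝ) 1
  hasPDF : ∀ e, HasPDF (A e) P volume
  pdf_le : ∀ e, ∀ᵐ x, pdf (A e) P volume x ≤ (φ : ℝ≥0∞)

end NetCoord

/-!
A sequence of `N` better-response moves that gains little in total is shown to be very unlikely, for
`N = O(n k)`. As the welfare, twice the potential, has range at most `2 n ^ 2`, an execution with `j N`
moves contains a stretch of `N` moves in which the movers gain at most `ε = n ^ 2 / j` in total.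

*Return forms.* If a player `v` is back at time `t + 1` at the strategy she had at time `r`, then the
sum of her gains in between is a linear form in the payoffs with integer coefficients
(`returnForm`), in which only those players enter that move in between. It is positive and bounded
by the total gain. Hence the return forms of a block of `ℓ` moves depend only on these moves
(`blockForms_subset_of_movePattern_eq`), and there are at most `(n k ^ 2) ^ ℓ` possibilities, without
a factor for the initial profile. If `R` of the forms are in echelon position, then all of them lie in
`(0, ε]` with probability at most `(φ ε) ^ R`, by integrating out one private variable after the
other (`pi_echelon_le`). So if every sequence of `N` moves contains a block with `ℓ ≤ D R`, a union
bound shows that slow improvement has probability at most `N (n k ^ 2) ^ D φ ε`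
(`prob_slowPayoffs_le`). Summed over `j ≤ k ^ n`, which bounds the length of every execution, this
gives an expectation of `φ (n k) ^ O(D)`.

*Arbitrary graphs, `D = O(k log (n k))`.* One return form for each player with a return in the block
(a heavy player) can be thinned out to half as many in echelon position, by greedy matching
(`exists_isEchelon_of_shared`). A halving argument finds a block in which the number of heavy players
is at least `ℓ / O(k log (n k))`: a new move, one to a strategy not played before in the block, remains
new when blocks are joined unless its player becomes heavy, and there are at most `n k` new moves
(`exists_heavy_block`).

*Complete graphs, `D = O(k)`.* Take a shortest block at least half of whose moves are returns. Cut at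
the moves of players without a return (light players), it falls into runs of moves of heavy players,
and by minimality a constant fraction of each run is new in the run. Unless there are at least
`ℓ / O(k)` heavy players, most of these moves are returns in the block, so they span the move of a
light player. As the graph is complete, the payoff between the returning player and that light player
enters the return form, and these forms are triangular with respect to time
(`exists_isEchelon_of_returns`).

If `k > n`, the bounds polynomial in `n ^ k` hold because there are only `k ^ n` profiles.
-/

namespace NetCoord

/-! ### Integer linear forms in echelon position -/

/-- The value of the linear form with integer coefficients `f` at `x`. -/
noncomputable def formValue {E : Type*} [Fintype E] (f : E → ℤ) (x : E → ℝ) : ℝ :=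
  ∑ e, (f e : ℝ) * x e

/-- A list of integer forms is in echelon position if each of them involves a variable that none of
the later ones involves. Echelon position is a certificate of linear independence. -/
def IsEchelon {E : Type*} : List (E → ℤ) → Prop
  | [] => True
  | f :: l => (∃ e, f e ≠ 0 ∧ ∀ g ∈ l, g e = 0) ∧ IsEchelon l

section Probability

theorem measurable_formValue {E : Type*} [Fintype E] (f : E → ℤ) : Measurable (formValue f) := by
  unfold formValue
  fun_prop

variable {E : Type*} [Fintype E] [DecidableEq E]

theorem formValue_update (f : E → ℤ) (x : E → ℝ) (e : E) (y : ℝ) :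
    formValue f (Function.update x e y) = f e * y + ∑ a ∈ Finset.univ.erase e, (f a : ℝ) * x a := by
  unfold formValue
  rw [← Finset.add_sum_erase _ _ (Finset.mem_univ e)]
  simp only [Function.update_self]
  congr 1
  refine Finset.sum_congr rfl fun a ha => ?_
  rw [Function.update_of_ne (Finset.ne_of_mem_erase ha)]

theorem formValue_update_of_eq_zero {f : E → ℤ} {e : E} (he : f e = 0) (x : E → ℝ) (y : ℝ) :
    formValue f (Function.update x e y) = formValue f x := by
  conv_rhs => rw [← Function.update_eq_self e x]
  rw [formValue_update, formValue_update, he]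
  simp

/-- A nonzero integer slope does not enlarge intervals under preimages. -/
theorem volume_affine_preimage_Ioc_le {c : ℤ} (hc : c ≠ 0) (b ε : ℝ) :
    volume {y : ℝ | 0 < c * y + b ∧ c * y + b ≤ ε} ≤ ENNReal.ofReal ε := by
  rcases le_or_gt ε 0 with hε | hε
  · have : {y : ℝ | 0 < c * y + b ∧ c * y + b ≤ ε} = ∅ := by
      ext y
      simp only [Set.mem_ofPred_eq, Set.mem_empty_iff_false, iff_false, not_and, not_le]
      intro h
      linarith
    simp [this]
  · rcases lt_or_gt_of_ne hc with h | h
    · have h1 : (c : ℝ) ≤ -1 := by exact_mod_cast Int.le_sub_one_of_lt h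
      refine (measure_mono (t := Set.Icc ((ε - b) / c) ((ε - b) / c + ε)) ?_).trans ?_
      · rintro y ⟨hy1, hy2⟩
        have h2 : (ε - b) / c * c = ε - b := div_mul_cancel₀ _ (by linarith)
        constructor
        · by_contra! hlt
          nlinarith
        · by_contra! hlt
          nlinarith
      · rw [Real.volume_Icc]
        simp
    · have h1 : (1 : ℝ) ≤ c := by exact_mod_cast h
      refine (measure_mono (t := Set.Icc (-b / c) (-b / c + ε)) ?_).trans ?_
      · rintro y ⟨hy1, hy2⟩
        have h2 : -b / c * c = -b := div_mul_cancel₀ _ (by linarith)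
        constructor
        · by_contra! hlt
          nlinarith
        · by_contra! hlt
          nlinarith
      · rw [Real.volume_Icc]
        simp

/-- Integrating out the private variable of the first form of an echelon list costs a factor `φ ε`;
the private variable leaves the remaining forms untouched. -/
theorem pi_echelon_le (μ : E → Measure ℝ) [∀ e, IsProbabilityMeasure (μ e)] (φ : ℝ≥0∞)
    (hμ : ∀ e s, μ e s ≤ φ * volume s) (ε : ℝ) (l : List (E → ℤ)) (hl : IsEchelon l) :
    Measure.pi μ {x | ∀ f ∈ l, 0 < formValue f x ∧ formValue f x ≤ ε}
      ≤ (φ * ENNReal.ofReal ε) ^ l.length := by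
  have hmeas : ∀ l : List (E → ℤ),
      MeasurableSet {x : E → ℝ | ∀ f ∈ l, 0 < formValue f x ∧ formValue f x ≤ ε} := by
    intro l
    have : {x : E → ℝ | ∀ f ∈ l, 0 < formValue f x ∧ formValue f x ≤ ε} =
        ⋂ f ∈ {f | f ∈ l}, formValue f ⁻¹' Set.Ioc 0 ε := by
      ext x
      simp
    rw [this]
    exact MeasurableSet.biInter (List.finite_toSet l).countable
      fun f _ => measurable_formValue f measurableSet_Ioc
  induction l with
  | nil => simp
  | cons f l ih =>
    obtain ⟨⟨e, hfe, hle⟩, hl'⟩ := hl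
    set S := {x : E → ℝ | ∀ f ∈ l, 0 < formValue f x ∧ formValue f x ≤ ε} with hS
    set T := {x : E → ℝ | ∀ g ∈ f :: l, 0 < formValue g x ∧ formValue g x ≤ ε} with hT
    have hSup : ∀ x y, Function.update x e y ∈ S ↔ x ∈ S := by
      intro x y
      simp only [hS, Set.mem_ofPred_eq]
      refine forall₂_congr fun g hg => ?_
      rw [formValue_update_of_eq_zero (hle g hg)]
    have key : ∫⁻ x, T.indicator 1 x ∂Measure.pi μ ≤
        ∫⁻ x, (φ * ENNReal.ofReal ε) * S.indicator 1 x ∂Measure.pi μ := by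
      refine lintegral_le_of_lmarginal_le {e} (measurable_one.indicator (hmeas _))
        ((measurable_one.indicator (hmeas _)).const_mul _) ?_
      intro x
      rw [lmarginal_singleton, lmarginal_singleton]
      by_cases hx : x ∈ S
      · have h1 : ∀ y, S.indicator (1 : (E → ℝ) → ℝ≥0∞) (Function.update x e y) = 1 := fun y => by
          rw [Set.indicator_of_mem ((hSup x y).2 hx)]
          rfl
        simp only [h1, mul_one, lintegral_const, measure_univ]
        set B := {y : ℝ | 0 < f e * y + ∑ a ∈ Finset.univ.erase e, (f a : ℝ) * x a ∧
            f e * y + ∑ a ∈ Finset.univ.erase e, (f a : ℝ) * x a ≤ ε} with hB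
        have h2 : ∀ y, T.indicator (1 : (E → ℝ) → ℝ≥0∞) (Function.update x e y) ≤
            B.indicator 1 y := by
          intro y
          by_cases hy : Function.update x e y ∈ T
          · have : y ∈ B := by
              have := hy f (List.mem_cons_self ..)
              rwa [formValue_update] at this
            rw [Set.indicator_of_mem hy, Set.indicator_of_mem this]
            rfl
          · rw [Set.indicator_of_notMem hy]
            exact zero_le
        calc _ ≤ ∫⁻ y, B.indicator 1 y ∂μ e := lintegral_mono h2
          _ ≤ μ e B := lintegral_indicator_one_le _
          _ ≤ φ * volume B := hμ _ _
          _ ≤ φ * ENNReal.ofReal ε := by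
            gcongr
            exact volume_affine_preimage_Ioc_le hfe _ _
      · have h1 : ∀ y, T.indicator (1 : (E → ℝ) → ℝ≥0∞) (Function.update x e y) = 0 := fun y => by
          refine Set.indicator_of_notMem (fun h => hx ((hSup x y).1 ?_)) _
          exact fun g hg => h g (List.mem_cons_of_mem _ hg)
        simp [h1]
    rw [lintegral_indicator_one (hmeas _), lintegral_const_mul _
      (measurable_one.indicator (hmeas _)), lintegral_indicator_one (hmeas _)] at key
    rw [List.length_cons, pow_succ']
    exact key.trans (by gcongr; exact ih hl')

end Probability

/-- Smoothed payoffs put all values of an echelon list of forms into `(0, ε]` with probability at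
most `(φ ε) ^ r`, where `r` is the number of forms. -/
theorem IsSmoothed.prob_echelon_le {V : Type*} {G : SimpleGraph V} {k : ℕ} {Ω : Type*}
    [MeasurableSpace Ω] {P : Measure Ω} [IsProbabilityMeasure P] {φ : ℝ≥0}
    {A : PayoffIndex G k → Ω → ℝ} [Fintype (PayoffIndex G k)] (hA : IsSmoothed P φ A) (ε : ℝ)
    (l : List (PayoffIndex G k → ℤ)) (hl : IsEchelon l) :
    P {ω | ∀ f ∈ l, 0 < formValue f (fun e => A e ω) ∧ formValue f (fun e => A e ω) ≤ ε}
      ≤ (φ * ENNReal.ofReal ε) ^ l.length := by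
  classical
  have hae : ∀ e, AEMeasurable (A e) P := fun e => (hA.hasPDF e).aemeasurable
  have hlaw := (iIndepFun_iff_map_fun_eq_pi_map hae).1 hA.indep
  have : ∀ e, IsProbabilityMeasure (P.map (A e)) := fun e => Measure.isProbabilityMeasure_map (hae e)
  have hdens : ∀ e s, P.map (A e) s ≤ (φ : ℝ≥0∞) * volume s := by
    intro e s
    have := hA.hasPDF e
    rw [map_eq_withDensity_pdf (A e) P volume, withDensity_apply' _ s]
    calc ∫⁻ x in s, pdf (A e) P volume x ≤ ∫⁻ x in s, (φ : ℝ≥0∞) :=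
          lintegral_mono_ae (ae_restrict_of_ae (hA.pdf_le e))
      _ = φ * volume s := by simp
  have := pi_echelon_le (fun e => P.map (A e)) φ hdens ε l hl
  rw [← hlaw] at this
  exact (Measure.le_map_apply (aemeasurable_pi_lambda _ hae) _).trans this

/-- A density bounded by `φ` on an interval of length `2` forces `1 ≤ 2 φ`. -/
theorem IsSmoothed.one_le_two_mul {V : Type*} {G : SimpleGraph V} {k : ℕ} {Ω : Type*}
    [MeasurableSpace Ω] {P : Measure Ω} [IsProbabilityMeasure P] {φ : ℝ≥0}
    {A : PayoffIndex G k → Ω → ℝ} (hA : IsSmoothed P φ A) (e : PayoffIndex G k) : 1 ≤ 2 * φ := by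
  have := hA.hasPDF e
  have hae : AEMeasurable (A e) P := (hA.hasPDF e).aemeasurable
  have h1 : P.map (A e) (Set.Icc (-1) 1) = 1 := by
    rw [Measure.map_apply_of_aemeasurable hae measurableSet_Icc]
    refine le_antisymm prob_le_one ?_
    rw [← measure_univ (μ := P)]
    refine measure_mono_ae ?_
    filter_upwards [hA.mem_Icc e] with ω h _ using h
  rw [map_eq_withDensity_pdf (A e) P volume, withDensity_apply' _ _] at h1
  have h2 : ∫⁻ x in Set.Icc (-1 : ℝ) 1, pdf (A e) P volume x ≤ φ * 2 := by
    calc ∫⁻ x in Set.Icc (-1 : ℝ) 1, pdf (A e) P volume x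
        ≤ ∫⁻ x in Set.Icc (-1 : ℝ) 1, (φ : ℝ≥0∞) :=
          lintegral_mono_ae (ae_restrict_of_ae (hA.pdf_le e))
      _ = φ * 2 := by
          simp only [lintegral_const, MeasurableSet.univ, Measure.restrict_apply, Set.univ_inter,
            Real.volume_Icc]
          norm_num
  rw [h1] at h2
  rw [mul_comm]
  exact_mod_cast h2

/-! ### Move sequences and return forms -/

section Forms

variable {V : Type*} {k : ℕ}

/-- During the first `L` steps of the sequence `s` of profiles, the step at time `t` changes the
strategy of the player `u t`, and nothing else. -/
def IsMoveSeq (s : ℕ → Profile V k) (u : ℕ → V) (L : ℕ) : Prop :=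
  ∀ t < L, s (t + 1) (u t) ≠ s t (u t) ∧ ∀ v, v ≠ u t → s (t + 1) v = s t v

/-- The moves made in the block of `ℓ` steps that starts at time `a`: at each step the player who
moves, her old strategy and her new strategy. -/
def movePattern (s : ℕ → Profile V k) (u : ℕ → V) (a ℓ : ℕ) : Fin ℓ → V × Fin k × Fin k :=
  fun i => (u (a + i), s (a + i) (u (a + i)), s (a + i + 1) (u (a + i)))

/-- The moves of a block determine the strategies of all players who move in it, throughout. -/
theorem eq_of_movePattern_eq {s s' : ℕ → Profile V k} {u u' : ℕ → V} {a a' ℓ : ℕ}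
    (hs : IsMoveSeq s u (a + ℓ)) (hs' : IsMoveSeq s' u' (a' + ℓ))
    (h : movePattern s u a ℓ = movePattern s' u' a' ℓ) {v : V} {i₀ : ℕ} (hi₀ : i₀ < ℓ)
    (hv : u (a + i₀) = v) {i : ℕ} (hi : i ≤ ℓ) : s (a + i) v = s' (a' + i) v := by
  have hp : ∀ i < ℓ, u (a + i) = u' (a' + i) ∧
      s (a + i) (u (a + i)) = s' (a' + i) (u' (a' + i)) ∧
      s (a + i + 1) (u (a + i)) = s' (a' + i + 1) (u' (a' + i)) := by
    intro i hi
    have := congrFun h ⟨i, hi⟩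
    simpa [movePattern] using this
  have step : ∀ i < ℓ, (s (a + i) v = s' (a' + i) v ↔ s (a + (i + 1)) v = s' (a' + (i + 1)) v) := by
    intro i hi
    obtain ⟨h1, h2, h3⟩ := hp i hi
    by_cases hvi : v = u (a + i)
    · have h1' : v = u' (a' + i) := hvi.trans h1
      rw [← hvi, ← h1'] at h2 h3
      exact ⟨fun _ => h3, fun _ => h2⟩
    · have h1' : v ≠ u' (a' + i) := h1 ▸ hvi
      rw [← add_assoc, ← add_assoc, (hs (a + i) (by omega)).2 v hvi,
        (hs' (a' + i) (by omega)).2 v h1']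
  have all : ∀ i ≤ ℓ, (s (a + 0) v = s' (a' + 0) v ↔ s (a + i) v = s' (a' + i) v) := by
    intro i
    induction i with
    | zero => simp
    | succ i ih => exact fun hi => (ih (by omega)).trans (step i (by omega))
  refine (all i hi).1 ((all i₀ hi₀.le).2 ?_)
  obtain ⟨h1, h2, h3⟩ := hp i₀ hi₀
  rwa [← h1, hv] at h2

variable [Fintype V] [DecidableEq V] (G : SimpleGraph V) [DecidableRel G.Adj]

/-- The total change of the payoff of `v` caused by the moves that `v` herself makes at the times
`r, …, t` of the sequence `s`, as an integer linear form in the payoff entries. At times at which `v`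
does not move the summand vanishes. -/
def returnForm (s : ℕ → Profile V k) (v : V) (r t : ℕ) : PayoffIndex G k → ℤ := fun e =>
  ∑ x : G.neighborSet v, ∑ τ ∈ Finset.Ico r (t + 1),
    ((if e.1 = s((v, s (τ + 1) v), (x.1, s τ x.1)) then 1 else 0) -
      (if e.1 = s((v, s τ v), (x.1, s τ x.1)) then 1 else 0))

/-- The return forms of the block of times `a, …, a + ℓ - 1`: the forms `returnForm G s v r t` such
that the player `v` moving at time `t` returns to the strategy she had at time `r`. -/
def blockForms (s : ℕ → Profile V k) (u : ℕ → V) (a ℓ : ℕ) : Set (PayoffIndex G k → ℤ) :=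
  {f | ∃ r t, a ≤ r ∧ r ≤ t ∧ t < a + ℓ ∧ s r (u t) = s (t + 1) (u t) ∧
    f = returnForm G s (u t) r t}

variable {G}

theorem formValue_returnForm (A : PayoffIndex G k → ℝ) (s : ℕ → Profile V k) (v : V) (r t : ℕ) :
    formValue (returnForm G s v r t) A = ∑ τ ∈ Finset.Ico r (t + 1),
      (payoff A v (Function.update (s τ) v (s (τ + 1) v)) - payoff A v (s τ)) := by
  have hind : ∀ (p : Sym2 (V × Fin k)) (hp : p ∈ (G.comap (Prod.fst : V × Fin k → V)).edgeSet),
      ∑ e : PayoffIndex G k, (if e.1 = p then (1 : ℝ) else 0) * A e = A ⟨p, hp⟩ := by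
    intro p hp
    rw [Finset.sum_eq_single ⟨p, hp⟩]
    · simp
    · rintro e - he
      rw [if_neg, zero_mul]
      exact fun h => he (Subtype.ext h)
    · simp
  unfold formValue returnForm payoff
  push_cast
  simp only [Finset.sum_mul]
  rw [Finset.sum_comm]
  simp only [← Finset.sum_sub_distrib]
  rw [Finset.sum_comm (s := Finset.Ico r (t + 1))]
  refine Finset.sum_congr rfl fun x _ => ?_
  rw [Finset.sum_comm]
  refine Finset.sum_congr rfl fun τ _ => ?_
  simp only [sub_mul, Finset.sum_sub_distrib]
  have hx : x.1 ≠ v := (G.ne_of_adj x.2).symm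
  rw [hind _ (show G.Adj v x.1 from x.2), hind _ (show G.Adj v x.1 from x.2)]
  simp [Function.update_of_ne hx]

/-- A return form of `v` involves only edges at `v`. -/
theorem exists_of_returnForm_ne_zero {s : ℕ → Profile V k} {v : V} {r t : ℕ} {e : PayoffIndex G k}
    (h : returnForm G s v r t e ≠ 0) :
    ∃ (i : Fin k) (w : V) (j : Fin k), G.Adj v w ∧ e.1 = s((v, i), (w, j)) := by
  obtain ⟨x, -, hx⟩ := Finset.exists_ne_zero_of_sum_ne_zero h
  obtain ⟨τ, -, hτ⟩ := Finset.exists_ne_zero_of_sum_ne_zero hx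
  by_cases h1 : e.1 = s((v, s (τ + 1) v), (x.1, s τ x.1))
  · exact ⟨_, _, _, x.2, h1⟩
  · by_cases h2 : e.1 = s((v, s τ v), (x.1, s τ x.1))
    · exact ⟨_, _, _, x.2, h2⟩
    · simp [h1, h2] at hτ

theorem returnForm_eq_zero {s : ℕ → Profile V k} {v v' w : V} {r t : ℕ} {e : PayoffIndex G k}
    {i j : Fin k} (he : e.1 = s((v, i), (w, j))) (hv : v' ≠ v) (hw : v' ≠ w) :
    returnForm G s v' r t e = 0 := by
  by_contra h
  obtain ⟨i', w', j', -, he'⟩ := exists_of_returnForm_ne_zero h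
  rw [he, Sym2.eq_iff] at he'
  simp only [Prod.mk.injEq] at he'
  rcases he' with ⟨⟨h1, -⟩, -⟩ | ⟨-, ⟨h1, -⟩⟩
  · exact hv h1.symm
  · exact hw h1.symm

theorem returnForm_apply {s : ℕ → Profile V k} {v w : V} {r t : ℕ} {e : PayoffIndex G k}
    {i j : Fin k} (hvw : G.Adj v w) (he : e.1 = s((v, i), (w, j))) :
    returnForm G s v r t e = ∑ τ ∈ Finset.Ico r (t + 1),
      if s τ w = j then ((if s (τ + 1) v = i then 1 else 0) - (if s τ v = i then 1 else 0)) else 0 := by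
  have hne : v ≠ w := G.ne_of_adj hvw
  have hiff : ∀ (x : V) (a b : Fin k), e.1 = s((v, a), (x, b)) ↔ x = w ∧ b = j ∧ a = i := by
    intro x a b
    rw [he, Sym2.eq_iff]
    simp only [Prod.mk.injEq]
    constructor
    · rintro (⟨⟨-, h1⟩, h2, h3⟩ | ⟨⟨h1, h2⟩, h3, h4⟩)
      · exact ⟨h2.symm, h3.symm, h1.symm⟩
      · exact absurd h3.symm hne
    · rintro ⟨rfl, rfl, rfl⟩
      simp
  unfold returnForm
  rw [Finset.sum_eq_single (⟨w, hvw⟩ : G.neighborSet v)]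
  · refine Finset.sum_congr rfl fun τ _ => ?_
    simp only [hiff, true_and]
    by_cases h : s τ w = j <;> simp [h]
  · rintro ⟨x, hx⟩ - hxw
    refine Finset.sum_eq_zero fun τ _ => ?_
    have : x ≠ w := fun h => hxw (Subtype.ext h)
    simp [hiff, this]
  · simp

/-- A player who stays put while `v` returns to a former strategy does not enter the return form. -/
theorem returnForm_apply_of_const {s : ℕ → Profile V k} {v w : V} {r t : ℕ} {e : PayoffIndex G k}
    {i j : Fin k} (hvw : G.Adj v w) (he : e.1 = s((v, i), (w, j))) (hrt : r ≤ t)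
    (hret : s r v = s (t + 1) v) (hw : ∀ τ ∈ Finset.Icc r t, s τ w = s r w) :
    returnForm G s v r t e = 0 := by
  rw [returnForm_apply hvw he]
  have : ∀ τ ∈ Finset.Ico r (t + 1), (if s τ w = j then
      (((if s (τ + 1) v = i then 1 else 0) - (if s τ v = i then 1 else 0) : ℤ)) else 0) =
      if s r w = j then (if s (τ + 1) v = i then 1 else 0) - (if s τ v = i then 1 else 0) else 0 := by
    intro τ hτ
    rw [hw τ (by simp only [Finset.mem_Ico, Finset.mem_Icc] at hτ ⊢; omega)]
  rw [Finset.sum_congr rfl this]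
  by_cases h : s r w = j
  · simp only [h, if_true]
    rw [Finset.sum_Ico_sub (fun τ => if s τ v = i then (1 : ℤ) else 0) (by omega), hret, sub_self]
  · simp [h]

/-- Only the moves of a block matter for its return forms, because the players who do not move in
the block do not enter them. -/
theorem blockForms_subset_of_movePattern_eq {s s' : ℕ → Profile V k} {u u' : ℕ → V} {a a' ℓ : ℕ}
    (hs : IsMoveSeq s u (a + ℓ)) (hs' : IsMoveSeq s' u' (a' + ℓ))
    (h : movePattern s u a ℓ = movePattern s' u' a' ℓ) :
    blockForms G s u a ℓ ⊆ blockForms G s' u' a' ℓ := by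
  rintro f ⟨r, t, har, hrt, htl, hret, rfl⟩
  obtain ⟨r, rfl⟩ := Nat.exists_eq_add_of_le har
  obtain ⟨t, rfl⟩ := Nat.exists_eq_add_of_le (har.trans hrt)
  have hu : ∀ i < ℓ, u (a + i) = u' (a' + i) := fun i hi =>
    congrArg Prod.fst (congrFun h ⟨i, hi⟩)
  have heq : ∀ {v : V} {i₀ : ℕ} (_ : i₀ < ℓ) (_ : u (a + i₀) = v) {i : ℕ} (_ : i ≤ ℓ),
      s (a + i) v = s' (a' + i) v := fun hi₀ hv => eq_of_movePattern_eq hs hs' h hi₀ hv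
  have ht : t < ℓ := by omega
  have hret' : s' (a' + r) (u' (a' + t)) = s' (a' + t + 1) (u' (a' + t)) := by
    rw [← hu t ht, add_assoc, ← heq ht rfl (by omega), ← heq ht rfl (by omega), hret, add_assoc]
  refine ⟨a' + r, a' + t, by omega, by omega, by omega, hret', ?_⟩
  ext e
  rw [← hu t ht] at hret' ⊢
  by_cases hinc : ∃ (i : Fin k) (w : V) (j : Fin k), G.Adj (u (a + t)) w ∧
      e.1 = s((u (a + t), i), (w, j))
  · obtain ⟨i, w, j, hvw, he⟩ := hinc
    by_cases hact : ∃ i₀ < ℓ, u (a + i₀) = w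
    · obtain ⟨i₀, hi₀, hw⟩ := hact
      rw [returnForm_apply hvw he, returnForm_apply hvw he, add_assoc, add_assoc,
        add_comm a r, add_comm a (t + 1), add_comm a' r, add_comm a' (t + 1),
        ← Finset.sum_Ico_add, ← Finset.sum_Ico_add]
      refine Finset.sum_congr rfl fun τ hτ => ?_
      rw [Finset.mem_Ico] at hτ
      rw [heq hi₀ hw (by omega), add_assoc, add_assoc, heq ht rfl (by omega),
        heq ht rfl (by omega)]
    · push Not at hact
      have hconst : ∀ (s : ℕ → Profile V k) (u : ℕ → V) (a : ℕ), IsMoveSeq s u (a + ℓ) →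
          (∀ i < ℓ, u (a + i) ≠ w) → ∀ i ≤ ℓ, s (a + i) w = s a w := by
        intro s u a hs hact i
        induction i with
        | zero => simp
        | succ i ih =>
          intro hi
          rw [← add_assoc, (hs (a + i) (by omega)).2 w (hact i (by omega)).symm, ih (by omega)]
      have hconst' : ∀ (s : ℕ → Profile V k) (u : ℕ → V) (a : ℕ), IsMoveSeq s u (a + ℓ) →
          (∀ i < ℓ, u (a + i) ≠ w) → ∀ τ ∈ Finset.Icc (a + r) (a + t), s τ w = s (a + r) w := by
        intro s u a hs hact τ hτ
        rw [Finset.mem_Icc] at hτ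
        obtain ⟨i, rfl⟩ := Nat.exists_eq_add_of_le (show a ≤ τ by omega)
        rw [hconst s u a hs hact i (by omega), hconst s u a hs hact r (by omega)]
      rw [returnForm_apply_of_const hvw he hrt hret (hconst' s u a hs hact),
        returnForm_apply_of_const hvw he (by omega) hret'
          (hconst' s' u' a' hs' fun i hi => hu i hi ▸ hact i hi)]
  · rw [not_imp_comm.1 exists_of_returnForm_ne_zero hinc,
      not_imp_comm.1 exists_of_returnForm_ne_zero hinc]

end Forms

/-! ### The potential -/

section Potential

variable {V : Type*} [Fintype V] {G : SimpleGraph V} [DecidableRel G.Adj] {k : ℕ}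

/-- The sum of the payoffs of all players, which is twice the usual potential of the game. -/
def welfare (A : PayoffIndex G k → ℝ) (σ : Profile V k) : ℝ := ∑ v, payoff A v σ

theorem abs_welfare_le (A : PayoffIndex G k → ℝ) (hA : ∀ e, A e ∈ Set.Icc (-1 : ℝ) 1)
    (σ : Profile V k) : |welfare A σ| ≤ (Fintype.card V : ℝ) ^ 2 := by
  have h1 : ∀ v, |payoff A v σ| ≤ Fintype.card V := by
    intro v
    calc |payoff A v σ| ≤ ∑ w : G.neighborSet v, |A ⟨s((v, σ v), (w.1, σ w.1)), w.2⟩| :=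
          Finset.abs_sum_le_sum_abs _ _
      _ ≤ ∑ w : G.neighborSet v, (1 : ℝ) := Finset.sum_le_sum fun w _ => abs_le.2 (hA _)
      _ = Fintype.card (G.neighborSet v) := by simp
      _ ≤ Fintype.card V := by exact_mod_cast Fintype.card_subtype_le _
  calc |welfare A σ| ≤ ∑ v, |payoff A v σ| := Finset.abs_sum_le_sum_abs _ _
    _ ≤ ∑ _v : V, (Fintype.card V : ℝ) := Finset.sum_le_sum fun v _ => h1 v
    _ = (Fintype.card V : ℝ) ^ 2 := by simp [sq]

variable [DecidableEq V]

/-- An edge payoff is common to both endpoints, so a gain of the player who moves counts twice. -/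
theorem welfare_update (A : PayoffIndex G k → ℝ) (σ : Profile V k) (u : V) (i : Fin k) :
    welfare A (Function.update σ u i) - welfare A σ =
      2 * (payoff A u (Function.update σ u i) - payoff A u σ) := by
  set a : Profile V k → V → V → ℝ := fun σ v w =>
    if h : G.Adj v w then A ⟨s((v, σ v), (w, σ w)), h⟩ else 0 with ha
  have hpay : ∀ σ v, payoff A v σ = ∑ w, a σ v w := by
    intro σ v
    rw [payoff, ha]
    simp only
    rw [← Finset.sum_subset (Finset.subset_univ (G.neighborFinset v))]
    · rw [← Finset.sum_coe_sort (G.neighborFinset v)]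
      refine Fintype.sum_equiv (Equiv.subtypeEquivRight (by simp)) _ _ fun x => ?_
      have : G.Adj v x.1 := x.2
      simp [this]
    · intro w _ hw
      have : ¬ G.Adj v w := by simpa using hw
      simp [this]
  have hsymm : ∀ σ v w, a σ v w = a σ w v := by
    intro σ v w
    simp only [ha]
    by_cases h : G.Adj v w
    · rw [dif_pos h, dif_pos h.symm]
      congr 2
      exact Sym2.eq_swap
    · rw [dif_neg h, dif_neg fun h' => h h'.symm]
  have hself : ∀ σ v, a σ v v = 0 := fun σ v => by simp [ha]
  set τ := Function.update σ u i with hτ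
  have hoff : ∀ v w, v ≠ u → w ≠ u → a τ v w = a σ v w := by
    intro v w hv hw
    simp only [ha, hτ, Function.update_of_ne hv, Function.update_of_ne hw]
  have h1 : ∀ v, v ≠ u → ∑ w, a τ v w - ∑ w, a σ v w = a τ u v - a σ u v := by
    intro v hv
    rw [← Finset.sum_sub_distrib, Finset.sum_eq_single u]
    · rw [hsymm τ v u, hsymm σ v u]
    · intro w _ hw
      rw [hoff v w hv hw, sub_self]
    · simp
  simp only [welfare, hpay]
  rw [← Finset.sum_sub_distrib, ← Finset.add_sum_erase _ _ (Finset.mem_univ u),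
    Finset.sum_congr rfl fun v hv => h1 v (Finset.ne_of_mem_erase hv), two_mul]
  congr 1
  rw [← Finset.sum_sub_distrib, ← Finset.add_sum_erase _ _ (Finset.mem_univ u)]
  simp [hself]

/-- The moves of the sequence `s` during its first `L` steps are better responses. -/
def IsImproving (A : PayoffIndex G k → ℝ) (s : ℕ → Profile V k) (u : ℕ → V) (L : ℕ) : Prop :=
  IsMoveSeq s u L ∧ ∀ t < L, payoff A (u t) (s t) < payoff A (u t) (s (t + 1))

theorem IsImproving.welfare_succ {A : PayoffIndex G k → ℝ} {s : ℕ → Profile V k} {u : ℕ → V}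
    {L : ℕ} (h : IsImproving A s u L) {t : ℕ} (ht : t < L) :
    welfare A (s (t + 1)) - welfare A (s t) =
      2 * (payoff A (u t) (s (t + 1)) - payoff A (u t) (s t)) := by
  have : s (t + 1) = Function.update (s t) (u t) (s (t + 1) (u t)) := by
    funext v
    by_cases hv : v = u t
    · subst hv
      simp
    · rw [Function.update_of_ne hv, (h.1 t ht).2 v hv]
  rw [this]
  exact welfare_update A (s t) (u t) _

theorem IsImproving.welfare_lt {A : PayoffIndex G k → ℝ} {s : ℕ → Profile V k} {u : ℕ → V}
    {L : ℕ} (h : IsImproving A s u L) {t t' : ℕ} (htt : t < t') (ht : t' ≤ L) :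
    welfare A (s t) < welfare A (s t') := by
  induction t', htt using Nat.le_induction with
  | base => linarith [h.welfare_succ ht, h.2 t ht]
  | succ n hn ih => linarith [ih (by omega), h.welfare_succ ht, h.2 n ht]

theorem IsImproving.welfare_le {A : PayoffIndex G k → ℝ} {s : ℕ → Profile V k} {u : ℕ → V}
    {L : ℕ} (h : IsImproving A s u L) {t t' : ℕ} (htt : t ≤ t') (ht : t' ≤ L) :
    welfare A (s t) ≤ welfare A (s t') := by
  rcases htt.eq_or_lt with rfl | hlt
  · exact le_rfl
  · exact (h.welfare_lt hlt ht).le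

/-- The return forms of an improving sequence are positive and at most half the welfare gain. -/
theorem IsImproving.returnForm_mem {A : PayoffIndex G k → ℝ} {s : ℕ → Profile V k} {u : ℕ → V}
    {L : ℕ} (h : IsImproving A s u L) {r t : ℕ} (hrt : r ≤ t) (ht : t < L) :
    0 < formValue (returnForm G s (u t) r t) A ∧
      formValue (returnForm G s (u t) r t) A ≤ (welfare A (s (t + 1)) - welfare A (s r)) / 2 := by
  rw [formValue_returnForm]
  set d : ℕ → ℝ := fun τ =>
    payoff A (u t) (Function.update (s τ) (u t) (s (τ + 1) (u t))) - payoff A (u t) (s τ) with hd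
  have key : ∀ τ < L, 0 ≤ d τ ∧ 2 * d τ ≤ welfare A (s (τ + 1)) - welfare A (s τ) ∧
      (u τ = u t → 0 < d τ) := by
    intro τ hτ
    by_cases hu : u τ = u t
    · have hw := h.welfare_succ hτ
      have hlt := h.2 τ hτ
      have h2 := welfare_update A (s τ) (u τ) (s (τ + 1) (u τ))
      have : s (τ + 1) = Function.update (s τ) (u τ) (s (τ + 1) (u τ)) := by
        funext v
        by_cases hv : v = u τ
        · subst hv
          simp
        · rw [Function.update_of_ne hv, (h.1 τ hτ).2 v hv]
      have hdτ : d τ = payoff A (u τ) (s (τ + 1)) - payoff A (u τ) (s τ) := by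
        simp only [hd]
        rw [← hu, ← this]
      rw [hdτ, hw]
      exact ⟨by linarith, le_rfl, fun _ => by linarith⟩
    · have : d τ = 0 := by
        simp only [hd]
        rw [(h.1 τ hτ).2 (u t) (Ne.symm hu)]
        simp
      rw [this]
      exact ⟨le_rfl, by linarith [h.welfare_le (Nat.le_succ τ) hτ], fun h => absurd h hu⟩
  constructor
  · refine Finset.sum_pos' (fun τ hτ => (key τ ?_).1) ⟨t, ?_, (key t ht).2.2 rfl⟩
    · rw [Finset.mem_Ico] at hτ
      omega
    · rw [Finset.mem_Ico]
      omega
  · have : ∑ τ ∈ Finset.Ico r (t + 1), 2 * d τ ≤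
        ∑ τ ∈ Finset.Ico r (t + 1), (welfare A (s (τ + 1)) - welfare A (s τ)) := by
      refine Finset.sum_le_sum fun τ hτ => (key τ ?_).2.1
      rw [Finset.mem_Ico] at hτ
      omega
    rw [Finset.sum_Ico_sub (fun τ => welfare A (s τ)) (by omega), ← Finset.mul_sum] at this
    linarith

end Potential

/-! ### Returns and heavy players -/

section Returns

variable {V : Type*} {k : ℕ}

/-- The move at time `t` returns to a strategy that the mover has already played since time `a`. -/
def IsReturn (s : ℕ → Profile V k) (u : ℕ → V) (a t : ℕ) : Prop :=
  ∃ r, a ≤ r ∧ r ≤ t ∧ s r (u t) = s (t + 1) (u t)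

open Classical in
/-- The times of the block `a, …, b - 1` at which the mover adopts a strategy that she has not played
before in the block. -/
noncomputable def newMoves (s : ℕ → Profile V k) (u : ℕ → V) (a b : ℕ) : Finset ℕ :=
  {t ∈ Finset.Ico a b | ¬ IsReturn s u a t}

open Classical in
/-- The players who return to a former strategy within the block of times `a, …, b - 1`. -/
noncomputable def heavy [Fintype V] (s : ℕ → Profile V k) (u : ℕ → V) (a b : ℕ) : Finset V :=
  {v | ∃ t ∈ Finset.Ico a b, u t = v ∧ IsReturn s u a t}

variable {s : ℕ → Profile V k} {u : ℕ → V}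

theorem mem_newMoves {a b t : ℕ} : t ∈ newMoves s u a b ↔ (a ≤ t ∧ t < b) ∧ ¬ IsReturn s u a t := by
  simp [newMoves]

theorem mem_heavy [Fintype V] {a b : ℕ} {v : V} :
    v ∈ heavy s u a b ↔ ∃ t, (a ≤ t ∧ t < b) ∧ u t = v ∧ IsReturn s u a t := by
  simp [heavy]

/-- A player makes at most `k` moves to strategies that are new to her. -/
theorem card_newMoves_filter_le [DecidableEq V] (a b : ℕ) (W : Finset V) :
    ((newMoves s u a b).filter (fun t => u t ∈ W)).card ≤ k * W.card := by
  have hinj : ∀ t ∈ newMoves s u a b, ∀ t' ∈ newMoves s u a b, t < t' →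
      u t = u t' → s (t + 1) (u t) ≠ s (t' + 1) (u t') := by
    intro t ht t' ht' hlt hu hs
    rw [mem_newMoves] at ht ht'
    exact ht'.2 ⟨t + 1, by omega, by omega, by rw [← hs, hu]⟩
  calc ((newMoves s u a b).filter (fun t => u t ∈ W)).card
      ≤ (W ×ˢ (Finset.univ : Finset (Fin k))).card := by
        refine Finset.card_le_card_of_injOn (fun t => (u t, s (t + 1) (u t))) ?_ ?_
        · intro t ht
          simp only [Finset.coe_filter, Set.mem_ofPred_eq] at ht
          simp [ht.2]
        · intro t ht t' ht' heq
          simp only [Finset.coe_filter, Set.mem_ofPred_eq] at ht ht'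
          simp only [Prod.mk.injEq] at heq
          rcases lt_trichotomy t t' with h | h | h
          · exact absurd heq.2 (hinj t ht.1 t' ht'.1 h heq.1)
          · exact h
          · exact absurd heq.2.symm (hinj t' ht'.1 t ht.1 h heq.1.symm)
    _ = k * W.card := by simp [mul_comm]

theorem card_newMoves_le [Fintype V] (a b : ℕ) :
    (newMoves s u a b).card ≤ k * Fintype.card V := by
  classical
  simpa using card_newMoves_filter_le (s := s) (u := u) a b Finset.univ

/-- When two adjacent blocks are joined, a new move can cease to be new only if its player becomes
heavy, and only `k` times for each such player. -/
theorem card_newMoves_add_le [Fintype V] {a m b : ℕ} (ham : a ≤ m) (hmb : m ≤ b) :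
    (newMoves s u a m).card + (newMoves s u m b).card ≤
      (newMoves s u a b).card + k * (heavy s u a b).card := by
  classical
  have h1 : (newMoves s u m b).card =
      ((newMoves s u m b).filter (fun t => IsReturn s u a t)).card +
        ((newMoves s u m b).filter (fun t => ¬ IsReturn s u a t)).card :=
    (Finset.card_filter_add_card_filter_not _).symm
  have h2 : ((newMoves s u m b).filter (fun t => IsReturn s u a t)).card ≤
      k * (heavy s u a b).card := by
    refine (Finset.card_le_card ?_).trans
      (card_newMoves_filter_le (s := s) (u := u) m b (heavy s u a b))
    intro t ht
    rw [Finset.mem_filter, mem_newMoves] at ht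
    rw [Finset.mem_filter, mem_newMoves, mem_heavy]
    exact ⟨ht.1, t, ⟨by omega, by omega⟩, rfl, ht.2⟩
  have h3 : (newMoves s u a m).card +
      ((newMoves s u m b).filter (fun t => ¬ IsReturn s u a t)).card ≤
        (newMoves s u a b).card := by
    rw [← Finset.card_union_of_disjoint]
    · refine Finset.card_le_card fun t ht => ?_
      rw [Finset.mem_union, Finset.mem_filter, mem_newMoves, mem_newMoves] at ht
      rw [mem_newMoves]
      rcases ht with ht | ht
      · exact ⟨⟨by omega, by omega⟩, ht.2⟩
      · exact ⟨⟨by omega, by omega⟩, ht.2⟩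
    · rw [Finset.disjoint_left]
      intro t ht ht'
      rw [Finset.mem_filter, mem_newMoves] at ht'
      rw [mem_newMoves] at ht
      omega
  omega

/-- Repeated halving: in a sequence of length `2 ^ h > 2 n k` some block has a `1 / (2 h k)` fraction
of heavy players. Otherwise joining blocks would lose so few new moves that more than `n k` of them
would survive. -/
theorem exists_heavy_block [Fintype V] {h N : ℕ} (hs : IsMoveSeq s u N) (hN : N = 2 ^ h)
    (hlarge : 2 * (k * Fintype.card V) < 2 ^ h) :
    ∃ a ℓ, 1 ≤ ℓ ∧ a + ℓ ≤ N ∧ ℓ ≤ 2 * h * k * (heavy s u a (a + ℓ)).card := by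
  by_contra! hcon
  have key : ∀ j ≤ h, ∀ a, a + 2 ^ j ≤ N →
      2 * h * 2 ^ j ≤ 2 * h * (newMoves s u a (a + 2 ^ j)).card + j * 2 ^ j := by
    intro j
    induction j with
    | zero =>
      intro _ a ha
      have : a ∈ newMoves s u a (a + 2 ^ 0) := by
        rw [mem_newMoves]
        refine ⟨⟨le_rfl, by simp⟩, ?_⟩
        rintro ⟨r, h1, h2, h3⟩
        obtain rfl : r = a := le_antisymm h2 h1
        exact (hs r (by omega)).1 h3.symm
      have := Finset.card_pos.2 ⟨a, this⟩
      nlinarith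
    | succ j ih =>
      intro hj a ha
      rw [pow_succ] at ha ⊢
      have e1 := ih (by omega) a (by omega)
      have e2 := ih (by omega) (a + 2 ^ j) (by omega)
      have e3 := card_newMoves_add_le (s := s) (u := u) (show a ≤ a + 2 ^ j by omega)
        (show a + 2 ^ j ≤ a + 2 ^ j + 2 ^ j by omega)
      have e4 := hcon a (2 ^ j * 2) (by have := Nat.one_le_two_pow (n := j); omega) ha
      rw [show a + 2 ^ j * 2 = a + 2 ^ j + 2 ^ j by ring] at e4 ⊢
      nlinarith
  have e := key h le_rfl 0 (by omega)
  have e2 := card_newMoves_le (s := s) (u := u) 0 (0 + 2 ^ h)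
  have hh : 0 < h := by
    rcases Nat.eq_zero_or_pos h with rfl | h0
    · have e0 := hcon 0 1 le_rfl (by simp [hN])
      have e3 := card_newMoves_le (s := s) (u := u) 0 1
      have : 0 ∈ newMoves s u 0 1 := by
        rw [mem_newMoves]
        refine ⟨⟨le_rfl, by simp⟩, ?_⟩
        rintro ⟨r, h1, h2, h3⟩
        obtain rfl : r = 0 := by omega
        exact (hs 0 (by simp [hN])).1 h3.symm
      have := Finset.card_pos.2 ⟨0, this⟩
      omega
    · exact h0
  have e3 : h * 2 ^ h ≤ 2 * h * (newMoves s u 0 (0 + 2 ^ h)).card := by nlinarith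
  have e4 : 2 ^ h ≤ 2 * (newMoves s u 0 (0 + 2 ^ h)).card := by
    refine Nat.le_of_mul_le_mul_left ?_ hh
    linarith
  omega

/-- A critical block: at least half of its moves are returns, but at most three quarters of the moves
of any of its sub-blocks are returns within the sub-block. It is a shortest block of the first kind. -/
theorem exists_critical_block [Fintype V] {N : ℕ} (hs : IsMoveSeq s u N)
    (hN : N = 2 * (k * Fintype.card V)) (hpos : 0 < N) :
    ∃ a ℓ, 1 ≤ ℓ ∧ a + ℓ ≤ N ∧ 2 * (newMoves s u a (a + ℓ)).card ≤ ℓ ∧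
      ∀ c d, a ≤ c → c ≤ d → d ≤ a + ℓ → d - c ≤ 4 * (newMoves s u c d).card := by
  classical
  have hex : ∃ ℓ, 1 ≤ ℓ ∧ ∃ a, a + ℓ ≤ N ∧ 2 * (newMoves s u a (a + ℓ)).card ≤ ℓ := by
    refine ⟨N, hpos, 0, by simp, ?_⟩
    have := card_newMoves_le (s := s) (u := u) 0 (0 + N)
    omega
  obtain ⟨h1, a, ha, hnew⟩ := Nat.find_spec hex
  have hmin := fun m hm => Nat.find_min hex (m := m) hm
  set ℓ := Nat.find hex with hℓ
  have hsub : ∀ c d, c < d → d ≤ N → d - c < ℓ → d - c < 2 * (newMoves s u c d).card := by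
    intro c d hcd hd hlt
    by_contra! hle
    refine hmin (d - c) hlt ⟨by omega, c, by omega, ?_⟩
    rwa [Nat.add_sub_cancel' hcd.le]
  have h2 : 2 ≤ ℓ := by
    by_contra! hlt
    have hone : ℓ = 1 := by omega
    rw [hone] at hnew ha
    have : a ∈ newMoves s u a (a + 1) := by
      rw [mem_newMoves]
      refine ⟨⟨le_rfl, by simp⟩, ?_⟩
      rintro ⟨r, h1, h2, h3⟩
      obtain rfl : r = a := le_antisymm h2 h1
      exact (hs r (by omega)).1 h3.symm
    have := Finset.card_pos.2 ⟨a, this⟩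
    omega
  refine ⟨a, ℓ, h1, ha, hnew, fun c d hac hcd hd => ?_⟩
  rcases hcd.eq_or_lt with rfl | hlt
  · simp
  · by_cases hfull : d - c < ℓ
    · have := hsub c d hlt (by omega) hfull
      omega
    · obtain rfl : c = a := by omega
      obtain rfl : d = c + ℓ := by omega
      have e1 := hsub c (c + ℓ - 1) (by omega) (by omega) (by omega)
      have e2 : (newMoves s u c (c + ℓ - 1)).card ≤ (newMoves s u c (c + ℓ)).card := by
        refine Finset.card_le_card fun t ht => ?_
        rw [mem_newMoves] at ht ⊢
        exact ⟨by omega, ht.2⟩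
      omega

/-- Cut a critical block into maximal runs of moves of heavy players. At least a quarter of the moves of
each run are new in the run, and among these at most `k` for each heavy player are new in the block.
The others are returns in the block that are new since the light player's move before their run. -/
theorem exists_many_returns [Fintype V] {a ℓ : ℕ}
    (hnew : 2 * (newMoves s u a (a + ℓ)).card ≤ ℓ)
    (hcrit : ∀ c d, a ≤ c → c ≤ d → d ≤ a + ℓ → d - c ≤ 4 * (newMoves s u c d).card) :
    ∃ T : Finset ℕ, (∀ t ∈ T, t < a + ℓ ∧ IsReturn s u a t ∧ ∃ p, a < p ∧ p ≤ t ∧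
        u (p - 1) ∉ heavy s u a (a + ℓ) ∧ (∀ τ, p ≤ τ → τ ≤ t → u τ ∈ heavy s u a (a + ℓ)) ∧
        ¬ IsReturn s u p t) ∧
      ℓ ≤ 8 * (T.card + k * (heavy s u a (a + ℓ)).card) := by
  classical
  set H := heavy s u a (a + ℓ) with hH
  set M := (Finset.Ico a (a + ℓ)).filter (fun t => u t ∈ H) with hM
  set R := M.filter (fun t => ∃ p, a ≤ p ∧ p ≤ t ∧ (p = a ∨ u (p - 1) ∉ H) ∧
    (∀ τ, p ≤ τ → τ ≤ t → u τ ∈ H) ∧ ¬ IsReturn s u p t) with hR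
  have hMcard : ℓ ≤ 2 * M.card := by
    have e1 : (Finset.Ico a (a + ℓ)).card ≤ (newMoves s u a (a + ℓ)).card + M.card := by
      refine (Finset.card_le_card ?_).trans (Finset.card_union_le _ _)
      intro t ht
      rw [Finset.mem_union, mem_newMoves, hM, Finset.mem_filter]
      rw [Finset.mem_Ico] at ht
      by_cases hret : IsReturn s u a t
      · exact Or.inr ⟨Finset.mem_Ico.2 ht, mem_heavy.2 ⟨t, ht, rfl, hret⟩⟩
      · exact Or.inl ⟨ht, hret⟩
    rw [Nat.card_Ico] at e1
    omega
  have hruns : ∀ c, a ≤ c → c ≤ a + ℓ →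
      (M.filter (· < c)).card ≤ 4 * (R.filter (· < c)).card := by
    intro c
    induction c using Nat.strong_induction_on with
    | _ c ih =>
    intro hac hcl
    have hex : ∃ p, a ≤ p ∧ p ≤ c ∧ ∀ τ, p ≤ τ → τ < c → u τ ∈ H :=
      ⟨c, hac, le_rfl, fun τ h1 h2 => by omega⟩
    obtain ⟨hap, hpc, hp⟩ := Nat.find_spec hex
    have hmin := fun m hm => Nat.find_min hex (m := m) hm
    set p := Nat.find hex
    have hpre : p = a ∨ u (p - 1) ∉ H := by
      by_contra! hcon
      refine hmin (p - 1) (by omega) ⟨by omega, by omega, fun τ h1 h2 => ?_⟩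
      rcases Nat.eq_or_lt_of_le h1 with h | h
      · exact h ▸ hcon.2
      · exact hp τ (by omega) h2
    rcases hpc.eq_or_lt with hpc | hpc
    · rcases hpre with h | h
      · have : M.filter (· < c) = ∅ := by
          rw [Finset.filter_eq_empty_iff]
          intro t ht
          rw [hM, Finset.mem_filter, Finset.mem_Ico] at ht
          omega
        simp [this]
      · rcases hac.eq_or_lt with hac' | hac'
        · have : M.filter (· < c) = ∅ := by
            rw [Finset.filter_eq_empty_iff]
            intro t ht
            rw [hM, Finset.mem_filter, Finset.mem_Ico] at ht
            omega
          simp [this]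
        · refine le_trans ?_ ((ih (c - 1) (by omega) (by omega) (by omega)).trans ?_)
          · refine Finset.card_le_card fun t ht => ?_
            rw [Finset.mem_filter] at ht ⊢
            refine ⟨ht.1, ?_⟩
            have h1 := (Finset.mem_filter.1 ht.1).2
            have : t ≠ c - 1 := fun h2 => h (by rw [hpc, ← h2]; exact h1)
            omega
          · gcongr
            omega
    · have e1 : (M.filter (· < c)).card ≤ (M.filter (· < p)).card + (c - p) := by
        rw [← Nat.card_Ico]
        refine (Finset.card_le_card ?_).trans (Finset.card_union_le _ _)
        intro t ht
        rw [Finset.mem_filter] at ht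
        rw [Finset.mem_union, Finset.mem_filter, Finset.mem_Ico]
        by_cases h : t < p
        · exact Or.inl ⟨ht.1, h⟩
        · exact Or.inr ⟨by omega, ht.2⟩
      have e2 : (R.filter (· < p)).card + (newMoves s u p c).card ≤ (R.filter (· < c)).card := by
        rw [← Finset.card_union_of_disjoint]
        · refine Finset.card_le_card fun t ht => ?_
          rw [Finset.mem_union, Finset.mem_filter, mem_newMoves] at ht
          rw [Finset.mem_filter]
          rcases ht with ht | ⟨ht, hr⟩
          · exact ⟨ht.1, by omega⟩
          · refine ⟨?_, ht.2⟩
            rw [hR, Finset.mem_filter, hM, Finset.mem_filter, Finset.mem_Ico]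
            exact ⟨⟨by omega, hp t ht.1 ht.2⟩, p, hap, ht.1, hpre,
              fun τ h1 h2 => hp τ h1 (by omega), hr⟩
        · rw [Finset.disjoint_left]
          intro t ht ht'
          rw [Finset.mem_filter] at ht
          rw [mem_newMoves] at ht'
          omega
      have e3 := hcrit p c hap hpc.le hcl
      have e4 := ih p hpc hap (by omega)
      omega
  have hRcard : M.card ≤ 4 * R.card := by
    have := hruns (a + ℓ) (by omega) le_rfl
    rwa [Finset.filter_true_of_mem, Finset.filter_true_of_mem] at this
    · intro t ht
      have := (Finset.mem_filter.1 (Finset.mem_filter.1 ht).1).1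
      exact (Finset.mem_Ico.1 this).2
    · intro t ht
      exact (Finset.mem_Ico.1 (Finset.mem_filter.1 ht).1).2
  refine ⟨R.filter (fun t => IsReturn s u a t), ?_, ?_⟩
  · intro t ht
    simp only [hR, hM, Finset.mem_filter, Finset.mem_Ico] at ht
    obtain ⟨⟨⟨h1, h2⟩, p, hap, hpt, hpre, hheavy, hpret⟩, hret⟩ := ht
    have hne : p ≠ a := fun h => hpret (h ▸ hret)
    exact ⟨h1.2, hret, p, by omega, hpt, hpre.resolve_left hne, hheavy, hpret⟩
  · have e1 : R.card = (R.filter (fun t => IsReturn s u a t)).card +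
        (R.filter (fun t => ¬ IsReturn s u a t)).card :=
      (Finset.card_filter_add_card_filter_not _).symm
    have e2 : (R.filter (fun t => ¬ IsReturn s u a t)).card ≤ k * H.card := by
      refine (Finset.card_le_card ?_).trans (card_newMoves_filter_le (s := s) (u := u) a (a + ℓ) H)
      intro t ht
      simp only [hR, hM, Finset.mem_filter, Finset.mem_Ico] at ht
      rw [Finset.mem_filter, mem_newMoves]
      exact ⟨⟨ht.1.1.1, ht.2⟩, ht.1.1.2⟩
    omega

end Returns

/-! ### Echelon families of return forms -/

/-- Forms indexed by vertices, each with a variable shared with at most one other vertex: greedy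
matching keeps at least half of them. -/
theorem exists_isEchelon_of_shared {V E : Type*} (F : V → E → ℤ) (W : Finset V)
    (hF : ∀ v ∈ W, ∃ e, F v e ≠ 0 ∧ ∃ w, ∀ v', v' ≠ v → v' ≠ w → F v' e = 0) :
    ∃ l : List (E → ℤ), IsEchelon l ∧ (∀ f ∈ l, ∃ v ∈ W, f = F v) ∧ W.card ≤ 2 * l.length := by
  classical
  induction W using Finset.strongInduction with
  | _ W ih =>
  rcases W.eq_empty_or_nonempty with rfl | ⟨v, hv⟩
  · exact ⟨[], trivial, by simp, by simp⟩
  · obtain ⟨e, he, w, hw⟩ := hF v hv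
    have hss : (W.erase v).erase w ⊂ W :=
      (Finset.erase_subset _ _).trans_ssubset (Finset.erase_ssubset hv)
    obtain ⟨l, hl, hlW, hcard⟩ := ih _ hss fun v' hv' => hF v' (hss.subset hv')
    refine ⟨F v :: l, ⟨⟨e, he, fun g hg => ?_⟩, hl⟩, ?_, ?_⟩
    · obtain ⟨v', hv', rfl⟩ := hlW g hg
      rw [Finset.mem_erase, Finset.mem_erase] at hv'
      exact hw v' hv'.2.1 hv'.1
    · intro f hf
      rcases List.mem_cons.1 hf with rfl | hf
      · exact ⟨v, hv, rfl⟩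
      · obtain ⟨v', hv', rfl⟩ := hlW f hf
        exact ⟨v', hss.subset hv', rfl⟩
    · have e1 := Finset.card_erase_of_mem hv
      have e2 := Finset.pred_card_le_card_erase (s := W.erase v) (a := w)
      rw [List.length_cons]
      omega

theorem exists_isEchelon_of_triangular {E : Type*} (F : ℕ → E → ℤ) (T : Finset ℕ)
    (hF : ∀ t ∈ T, ∃ e, F t e ≠ 0 ∧ ∀ t' ∈ T, t' < t → F t' e = 0) :
    ∃ l : List (E → ℤ), IsEchelon l ∧ (∀ f ∈ l, ∃ t ∈ T, f = F t) ∧ T.card = l.length := by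
  induction T using Finset.induction_on_max with
  | empty => exact ⟨[], trivial, by simp, by simp⟩
  | insert t T hmax ih =>
    obtain ⟨l, hl, hlT, hcard⟩ := ih fun t' ht' => by
      obtain ⟨e, he, h⟩ := hF t' (Finset.mem_insert_of_mem ht')
      exact ⟨e, he, fun t'' ht'' => h t'' (Finset.mem_insert_of_mem ht'')⟩
    obtain ⟨e, he, h⟩ := hF t (Finset.mem_insert_self _ _)
    refine ⟨F t :: l, ⟨⟨e, he, fun g hg => ?_⟩, hl⟩, ?_, ?_⟩
    · obtain ⟨t', ht', rfl⟩ := hlT g hg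
      exact h t' (Finset.mem_insert_of_mem ht') (hmax t' ht')
    · intro f hf
      rcases List.mem_cons.1 hf with rfl | hf
      · exact ⟨t, Finset.mem_insert_self _ _, rfl⟩
      · obtain ⟨t', ht', rfl⟩ := hlT f hf
        exact ⟨t', Finset.mem_insert_of_mem ht', rfl⟩
    · rw [Finset.card_insert_of_notMem fun h => lt_irrefl _ (hmax t h), hcard, List.length_cons]

section Blocks

variable {V : Type*} [Fintype V] [DecidableEq V] {k : ℕ} (G : SimpleGraph V) [DecidableRel G.Adj]

/-- Some block among the first `N` moves has an echelon list of return forms which is at most `D`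
times shorter than the block. -/
def HasEchelonBlock (s : ℕ → Profile V k) (u : ℕ → V) (N D : ℕ) : Prop :=
  ∃ a ℓ, 1 ≤ ℓ ∧ a + ℓ ≤ N ∧ ∃ l : List (PayoffIndex G k → ℤ), IsEchelon l ∧
    (∀ f ∈ l, f ∈ blockForms G s u a ℓ) ∧ ℓ ≤ D * l.length

variable {G} {A : PayoffIndex G k → ℝ} {s : ℕ → Profile V k} {u : ℕ → V}

/-- One return form for each heavy player, thinned out by greedy matching. The forms do not vanish
because the moves are improving. -/
theorem IsImproving.exists_isEchelon_heavy {N a ℓ : ℕ} (h : IsImproving A s u N)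
    (ha : a + ℓ ≤ N) :
    ∃ l : List (PayoffIndex G k → ℤ), IsEchelon l ∧ (∀ f ∈ l, f ∈ blockForms G s u a ℓ) ∧
      (heavy s u a (a + ℓ)).card ≤ 2 * l.length := by
  have hex : ∀ v, ∃ r t, v ∈ heavy s u a (a + ℓ) →
      a ≤ r ∧ r ≤ t ∧ t < a + ℓ ∧ s r (u t) = s (t + 1) (u t) ∧ u t = v := by
    intro v
    by_cases hv : v ∈ heavy s u a (a + ℓ)
    · obtain ⟨t, ht, hu, r, har, hrt, hr⟩ := mem_heavy.1 hv
      exact ⟨r, t, fun _ => ⟨har, hrt, ht.2, hr, hu⟩⟩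
    · exact ⟨0, 0, fun h => absurd h hv⟩
  choose r t hrt using hex
  obtain ⟨l, hl, hlF, hcard⟩ := exists_isEchelon_of_shared
    (fun v => returnForm G s v (r v) (t v)) (heavy s u a (a + ℓ)) (by
      intro v hv
      obtain ⟨h1, h2, h3, h4, h5⟩ := hrt v hv
      have hpos := (h.returnForm_mem h2 (show t v < N by omega)).1
      rw [h5] at hpos
      have hne : ∃ e, returnForm G s v (r v) (t v) e ≠ 0 := by
        by_contra! hzero
        simp [formValue, hzero] at hpos
      obtain ⟨e, he⟩ := hne
      obtain ⟨i, w, j, -, hew⟩ := exists_of_returnForm_ne_zero he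
      exact ⟨e, he, w, fun v' hv' hw' => returnForm_eq_zero hew hv' hw'⟩)
  refine ⟨l, hl, fun f hf => ?_, hcard⟩
  obtain ⟨v, hv, rfl⟩ := hlF f hf
  obtain ⟨h1, h2, h3, h4, h5⟩ := hrt v hv
  exact ⟨r v, t v, h1, h2, h3, h4, by rw [h5]⟩

/-- The quasi-polynomial case: arbitrary game graphs. -/
theorem IsImproving.hasEchelonBlock {h N : ℕ} (hs : IsImproving A s u N) (hN : N = 2 ^ h)
    (hlarge : 2 * (k * Fintype.card V) < 2 ^ h) : HasEchelonBlock G s u N (4 * h * k) := by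
  obtain ⟨a, ℓ, h1, h2, h3⟩ := exists_heavy_block hs.1 hN hlarge
  obtain ⟨l, hl, hlF, hcard⟩ := hs.exists_isEchelon_heavy h2
  refine ⟨a, ℓ, h1, h2, l, hl, hlF, h3.trans ?_⟩
  calc 2 * h * k * (heavy s u a (a + ℓ)).card ≤ 2 * h * k * (2 * l.length) := by gcongr
    _ = 4 * h * k * l.length := by ring

/-- The coefficient of a return form at a payoff of the player `w` playing `j`, when `w` plays `j`
exactly from time `p` on. -/
theorem returnForm_apply_of_switch {v w : V} {r t p : ℕ} {e : PayoffIndex G k} {i j : Fin k}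
    (hvw : G.Adj v w) (he : e.1 = s((v, i), (w, j))) (hrt : r ≤ t) (hpt : p ≤ t)
    (hbefore : ∀ τ, r ≤ τ → τ < p → s τ w ≠ j) (hafter : ∀ τ, p ≤ τ → τ ≤ t → s τ w = j) :
    returnForm G s v r t e =
      (if s (t + 1) v = i then 1 else 0) - (if s (max r p) v = i then 1 else 0) := by
  rw [returnForm_apply hvw he,
    ← Finset.sum_subset (s₁ := Finset.Ico (max r p) (t + 1))
      (Finset.Ico_subset_Ico (le_max_left _ _) le_rfl),
    ← Finset.sum_Ico_sub (fun τ => if s τ v = i then (1 : ℤ) else 0) (by omega)]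
  · refine Finset.sum_congr rfl fun τ hτ => ?_
    rw [Finset.mem_Ico] at hτ
    rw [if_pos (hafter τ (by omega) (by omega))]
  · intro τ h1 h2
    rw [Finset.mem_Ico] at h1 h2
    rw [if_neg (hbefore τ (by omega) (by omega))]

/-- On the complete graph, a return of a heavy player `v` that spans the move of a light player `w` to
a strategy `j`, and is the first visit to its strategy `i` since then, involves the payoff of
`(v, i)` against `(w, j)`; no earlier such return does. -/
theorem exists_isEchelon_of_returns {a ℓ : ℕ} (hG : G = ⊤) (hs : IsMoveSeq s u (a + ℓ))
    (T : Finset ℕ) (hT : ∀ t ∈ T, t < a + ℓ ∧ IsReturn s u a t ∧ ∃ p, a < p ∧ p ≤ t ∧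
      u (p - 1) ∉ heavy s u a (a + ℓ) ∧ (∀ τ, p ≤ τ → τ ≤ t → u τ ∈ heavy s u a (a + ℓ)) ∧
      ¬ IsReturn s u p t) :
    ∃ l : List (PayoffIndex G k → ℤ), IsEchelon l ∧ (∀ f ∈ l, f ∈ blockForms G s u a ℓ) ∧
      T.card = l.length := by
  set H := heavy s u a (a + ℓ) with hH
  have hex : ∀ t, ∃ r, t ∈ T → a ≤ r ∧ r ≤ t ∧ s r (u t) = s (t + 1) (u t) := by
    intro t
    by_cases ht : t ∈ T
    · obtain ⟨r, hr⟩ := (hT t ht).2.1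
      exact ⟨r, fun _ => hr⟩
    · exact ⟨0, fun h => absurd h ht⟩
  choose r hr using hex
  have hlightFacts : ∀ p t, a < p → p ≤ t → t < a + ℓ → u (p - 1) ∉ H →
      (∀ τ, p ≤ τ → τ ≤ t → u τ ∈ H) →
      (∀ τ, a ≤ τ → τ < p → s τ (u (p - 1)) ≠ s p (u (p - 1))) ∧
      (∀ τ, p ≤ τ → τ ≤ t → s τ (u (p - 1)) = s p (u (p - 1))) := by
    intro p t hap hpt htl hlight hheavy
    constructor
    · intro τ haτ hτp heq
      refine hlight (mem_heavy.2 ⟨p - 1, ⟨by omega, by omega⟩, rfl, τ, haτ, by omega, ?_⟩)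
      rwa [Nat.sub_add_cancel (by omega)]
    · intro τ hpτ
      induction τ, hpτ using Nat.le_induction with
      | base => exact fun _ => rfl
      | succ τ hpτ ih =>
        intro hτt
        rw [(hs τ (by omega)).2, ih (by omega)]
        exact fun h => hlight (h ▸ hheavy τ hpτ (by omega))
  obtain ⟨l, hl, hlF, hcard⟩ := exists_isEchelon_of_triangular
    (fun t => returnForm G s (u t) (r t) t) T (by
      intro t ht
      obtain ⟨htl, hret, p, hap, hpt, hlight, hheavy, hpret⟩ := hT t ht
      obtain ⟨har, hrt, hrs⟩ := hr t ht
      obtain ⟨hbefore, hafter⟩ := hlightFacts p t hap hpt htl hlight hheavy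
      set w := u (p - 1) with hw
      set j := s p w with hj
      have htw : u t ≠ w := fun h => hlight (h ▸ hheavy t hpt le_rfl)
      have hadj : G.Adj (u t) w := by
        rw [hG]
        exact htw
      have haway : ∀ τ, p ≤ τ → τ ≤ t → s τ (u t) ≠ s (t + 1) (u t) :=
        fun τ h1 h2 h3 => hpret ⟨τ, h1, h2, h3⟩
      have hrp : r t < p := by
        by_contra! h
        exact haway (r t) h hrt hrs
      refine ⟨⟨s((u t, s (t + 1) (u t)), (w, j)), hadj⟩, ?_, ?_⟩
      · rw [returnForm_apply_of_switch hadj rfl hrt hpt (fun τ h1 => hbefore τ (har.trans h1)) hafter,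
          if_pos rfl, max_eq_right hrp.le, if_neg (haway p le_rfl hpt)]
        simp
      · intro t' ht' hlt
        obtain ⟨htl', -, p', hap', hpt', hlight', hheavy', -⟩ := hT t' ht'
        obtain ⟨har', hrt', hrs'⟩ := hr t' ht'
        have hw' : u t' ≠ w := fun h => hlight (h ▸ hheavy' t' hpt' le_rfl)
        by_cases hv : u t' = u t
        · by_cases hpt'' : p ≤ t'
          · -- between `p` and `t` the player `u t` stays away from her strategy at time `t + 1`
            simp only [hv]
            rw [returnForm_apply_of_switch hadj rfl hrt' hpt''
              (fun τ h1 => hbefore τ (har'.trans h1)) (fun τ h1 h2 => hafter τ h1 (by omega)),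
              if_neg (haway (t' + 1) (by omega) (by omega)),
              if_neg (haway (max (r t') p) (le_max_right _ _) (by omega)), sub_self]
          · simp only [hv]
            rw [returnForm_apply hadj rfl]
            refine Finset.sum_eq_zero fun τ hτ => ?_
            rw [Finset.mem_Ico] at hτ
            rw [if_neg (hbefore τ (by omega) (by omega))]
        · exact returnForm_eq_zero rfl hv hw')
  refine ⟨l, hl, fun f hf => ?_, hcard⟩
  obtain ⟨t, ht, rfl⟩ := hlF f hf
  obtain ⟨h1, h2, h3⟩ := hr t ht
  exact ⟨r t, t, h1, h2, (hT t ht).1, h3, rfl⟩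

/-- The polynomial case: complete game graphs. If a critical block has few heavy players, then many of
its returns span a move of a light player. -/
theorem IsImproving.hasEchelonBlock_of_eq_top {N : ℕ} (hG : G = ⊤) (hs : IsImproving A s u N)
    (hN : N = 2 * (k * Fintype.card V)) (hpos : 0 < N) : HasEchelonBlock G s u N (32 * k) := by
  obtain ⟨a, ℓ, h1, h2, hnew, hcrit⟩ := exists_critical_block hs.1 hN hpos
  obtain ⟨T, hT, hcard⟩ := exists_many_returns hnew hcrit
  have hk : 0 < k := by
    rcases Nat.eq_zero_or_pos k with rfl | hk
    · simp [hN] at hpos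
    · exact hk
  by_cases hcase : T.card ≤ k * (heavy s u a (a + ℓ)).card
  · obtain ⟨l, hl, hlF, hl2⟩ := hs.exists_isEchelon_heavy h2
    refine ⟨a, ℓ, h1, h2, l, hl, hlF, ?_⟩
    calc ℓ ≤ 16 * k * (heavy s u a (a + ℓ)).card := by linarith
      _ ≤ 16 * k * (2 * l.length) := by gcongr
      _ = 32 * k * l.length := by ring
  · obtain ⟨l, hl, hlF, hl2⟩ := exists_isEchelon_of_returns hG
      (fun t ht => hs.1 t (by omega)) T hT
    refine ⟨a, ℓ, h1, h2, l, hl, hlF, ?_⟩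
    calc ℓ ≤ 16 * l.length := by omega
      _ ≤ 32 * k * l.length := by
        gcongr
        omega

end Blocks

/-! ### Slow improvement is unlikely -/

section Slow

variable {V : Type*} [Fintype V] [DecidableEq V] {k : ℕ} (G : SimpleGraph V) [DecidableRel G.Adj]

/-- The payoffs for which some sequence of `N` improving moves raises the welfare by at most `2 ε`,
that is, the sum of the gains of the moving players is at most `ε`. -/
def slowPayoffs (k N : ℕ) (ε : ℝ) : Set (PayoffIndex G k → ℝ) :=
  {A | ∃ s u, IsImproving A s u N ∧ (welfare A (s N) - welfare A (s 0)) / 2 ≤ ε}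

/-- `l` is an echelon list, at most `D` times shorter than the block, of return forms of some block of
`ℓ` moves with pattern `π`. -/
def IsPatternCertificate {ℓ : ℕ} (D : ℕ) (π : Fin ℓ → V × Fin k × Fin k)
    (l : List (PayoffIndex G k → ℤ)) : Prop :=
  (∃ (s : ℕ → Profile V k) (u : ℕ → V) (a : ℕ), IsMoveSeq s u (a + ℓ) ∧ movePattern s u a ℓ = π ∧
    ∀ f ∈ l, f ∈ blockForms G s u a ℓ) ∧ IsEchelon l ∧ ℓ ≤ D * l.length

open Classical in
/-- The payoffs at which all forms of one chosen certificate of the pattern `π` have values in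
`(0, ε]`. The set is empty if `π` has no certificate. -/
noncomputable def patternEvent {ℓ : ℕ} (D : ℕ) (ε : ℝ) (π : Fin ℓ → V × Fin k × Fin k) :
    Set (PayoffIndex G k → ℝ) :=
  if h : ∃ l, IsPatternCertificate G D π l then
    {A | ∀ f ∈ h.choose, 0 < formValue f A ∧ formValue f A ≤ ε} else ∅

variable {G}

/-- The chosen certificate may come from another sequence of moves, but since the return forms depend
only on the pattern, its forms are return forms of the given sequence as well. -/
theorem slowPayoffs_subset {N D : ℕ} {ε : ℝ}
    (hblock : ∀ (A : PayoffIndex G k → ℝ) s u, IsImproving A s u N → HasEchelonBlock G s u N D) :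
    slowPayoffs G k N ε ⊆ ⋃ ℓ ∈ Finset.Icc 1 N, ⋃ π : Fin ℓ → V × Fin k × Fin k,
      patternEvent G D ε π := by
  rintro A ⟨s, u, himp, hslow⟩
  obtain ⟨a, ℓ, h1, h2, l, hl, hlF, hlen⟩ := hblock A s u himp
  have hs : IsMoveSeq s u (a + ℓ) := fun t ht => himp.1 t (by omega)
  have hex : ∃ l, IsPatternCertificate G D (movePattern s u a ℓ) l :=
    ⟨l, ⟨s, u, a, hs, rfl, hlF⟩, hl, hlen⟩
  rw [Set.mem_iUnion₂]
  refine ⟨ℓ, Finset.mem_Icc.2 ⟨h1, by omega⟩, Set.mem_iUnion.2 ⟨movePattern s u a ℓ, ?_⟩⟩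
  rw [patternEvent, dif_pos hex]
  obtain ⟨⟨s', u', a', hs', hpat, hF⟩, -, -⟩ := hex.choose_spec
  intro f hf
  obtain ⟨r, t, har, hrt, ht, -, rfl⟩ := blockForms_subset_of_movePattern_eq hs' hs hpat (hF f hf)
  obtain ⟨e1, e2⟩ := himp.returnForm_mem hrt (show t < N by omega)
  have e3 := himp.welfare_le (Nat.zero_le r) (show r ≤ N by omega)
  have e4 := himp.welfare_le (show t + 1 ≤ N by omega) le_rfl
  exact ⟨e1, by linarith⟩

variable {Ω : Type*} [MeasurableSpace Ω] {P : Measure Ω} [IsProbabilityMeasure P] {φ : ℝ≥0}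
  {A : PayoffIndex G k → Ω → ℝ}

/-- The probability of one pattern beats the number of patterns of its length. -/
theorem prob_patternEvent_le (hA : IsSmoothed P φ A) {ℓ D : ℕ} (hℓ : 1 ≤ ℓ) {ε : ℝ} {B : ℕ}
    (hB : 1 ≤ B) (hsmall : (B : ℝ≥0∞) ^ D * (φ * ENNReal.ofReal ε) ≤ 1)
    (π : Fin ℓ → V × Fin k × Fin k) :
    P {ω | (fun e => A e ω) ∈ patternEvent G D ε π} ≤
      (B : ℝ≥0∞) ^ D * (φ * ENNReal.ofReal ε) / (B : ℝ≥0∞) ^ ℓ := by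
  by_cases hex : ∃ l, IsPatternCertificate G D π l
  · rw [patternEvent, dif_pos hex]
    obtain ⟨-, hl, hlen⟩ := hex.choose_spec
    set l := hex.choose
    have hB' : (1 : ℝ≥0∞) ≤ B := by exact_mod_cast hB
    have hr : l.length ≠ 0 := by
      intro h
      rw [h] at hlen
      omega
    refine (hA.prob_echelon_le ε l hl).trans ?_
    rw [ENNReal.le_div_iff_mul_le (Or.inl (by positivity))
      (Or.inl (ENNReal.pow_ne_top (ENNReal.natCast_ne_top B)))]
    calc (φ * ENNReal.ofReal ε) ^ l.length * (B : ℝ≥0∞) ^ ℓ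
        ≤ (φ * ENNReal.ofReal ε) ^ l.length * (B : ℝ≥0∞) ^ (D * l.length) := by gcongr
      _ = ((B : ℝ≥0∞) ^ D * (φ * ENNReal.ofReal ε)) ^ l.length := by
          rw [pow_mul, ← mul_pow, mul_comm]
      _ ≤ (B : ℝ≥0∞) ^ D * (φ * ENNReal.ofReal ε) := pow_le_of_le_one zero_le hsmall hr
  · rw [patternEvent, dif_neg hex]
    simp

/-- Union bound over the lengths and the move patterns of a block. -/
theorem prob_slowPayoffs_le (hA : IsSmoothed P φ A) {N D : ℕ} (hN : 1 ≤ N) (hk : 1 ≤ k)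
    [Nonempty V] (ε : ℝ)
    (hblock : ∀ (A : PayoffIndex G k → ℝ) s u, IsImproving A s u N → HasEchelonBlock G s u N D) :
    P {ω | (fun e => A e ω) ∈ slowPayoffs G k N ε} ≤
      N * (((Fintype.card V * k ^ 2 : ℕ) : ℝ≥0∞) ^ D * (φ * ENNReal.ofReal ε)) := by
  set B := Fintype.card V * k ^ 2 with hBdef
  have hB : 1 ≤ B := Nat.mul_pos Fintype.card_pos (by positivity)
  have hN' : (1 : ℝ≥0∞) ≤ N := by exact_mod_cast hN
  rcases le_total ((B : ℝ≥0∞) ^ D * (φ * ENNReal.ofReal ε)) 1 with hsmall | hlarge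
  · calc P {ω | (fun e => A e ω) ∈ slowPayoffs G k N ε}
        ≤ P (⋃ ℓ ∈ Finset.Icc 1 N, ⋃ π : Fin ℓ → V × Fin k × Fin k,
            {ω | (fun e => A e ω) ∈ patternEvent G D ε π}) := by
          refine measure_mono fun ω hω => ?_
          simpa using slowPayoffs_subset hblock hω
      _ ≤ ∑ ℓ ∈ Finset.Icc 1 N, ∑ π : Fin ℓ → V × Fin k × Fin k,
            P {ω | (fun e => A e ω) ∈ patternEvent G D ε π} :=
          (measure_biUnion_finset_le _ _).trans
            (Finset.sum_le_sum fun ℓ _ => measure_iUnion_fintype_le _ _)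
      _ ≤ ∑ ℓ ∈ Finset.Icc 1 N, ∑ π : Fin ℓ → V × Fin k × Fin k,
            (B : ℝ≥0∞) ^ D * (φ * ENNReal.ofReal ε) / (B : ℝ≥0∞) ^ ℓ :=
          Finset.sum_le_sum fun ℓ hℓ => Finset.sum_le_sum fun π _ =>
            prob_patternEvent_le hA (Finset.mem_Icc.1 hℓ).1 hB hsmall π
      _ = ∑ ℓ ∈ Finset.Icc 1 N, (B : ℝ≥0∞) ^ D * (φ * ENNReal.ofReal ε) := by
          refine Finset.sum_congr rfl fun ℓ _ => ?_
          have hcard : ((Finset.univ : Finset (Fin ℓ → V × Fin k × Fin k)).card : ℝ≥0∞) =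
              (B : ℝ≥0∞) ^ ℓ := by
            rw [Finset.card_univ]
            simp [hBdef, sq]
          have hB0 : (B : ℝ≥0∞) ≠ 0 := by
            exact_mod_cast (by omega : B ≠ 0)
          rw [Finset.sum_const, nsmul_eq_mul, hcard]
          exact ENNReal.mul_div_cancel (pow_ne_zero _ hB0)
            (ENNReal.pow_ne_top (ENNReal.natCast_ne_top B))
      _ = N * ((B : ℝ≥0∞) ^ D * (φ * ENNReal.ofReal ε)) := by simp
  · exact prob_le_one.trans (one_le_mul hN' hlarge)

end Slow

/-! ### Executions of better-response dynamics -/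

section Dynamics

variable {V : Type*} [Fintype V] {G : SimpleGraph V} [DecidableRel G.Adj] {k : ℕ}
  {A : PayoffIndex G k → ℝ}

/-- Among `j` consecutive stretches of `N` improving moves, one raises the welfare by at most a
`1 / j` fraction of its range. -/
theorem IsImproving.mem_slowPayoffs (hA : ∀ e, A e ∈ Set.Icc (-1 : ℝ) 1) {s : ℕ → Profile V k}
    {u : ℕ → V} {m N j : ℕ} (h : IsImproving A s u m) (hj : 1 ≤ j) (hm : j * N ≤ m) :
    A ∈ slowPayoffs G k N ((Fintype.card V : ℝ) ^ 2 / j) := by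
  have hj' : (0 : ℝ) < j := by exact_mod_cast hj
  have hsum : ∑ i ∈ Finset.range j, (welfare A (s ((i + 1) * N)) - welfare A (s (i * N))) / 2 ≤
      ∑ _i ∈ Finset.range j, (Fintype.card V : ℝ) ^ 2 / j := by
    rw [← Finset.sum_div, Finset.sum_range_sub (fun i => welfare A (s (i * N)))]
    simp only [Finset.sum_const, Finset.card_range, nsmul_eq_mul]
    rw [mul_div_cancel₀ _ hj'.ne']
    have e1 := abs_le.1 (abs_welfare_le A hA (s (j * N)))
    have e2 := abs_le.1 (abs_welfare_le A hA (s (0 * N)))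
    linarith
  obtain ⟨i, hi, hle⟩ := Finset.exists_le_of_sum_le (Finset.nonempty_range_iff.2 (by omega)) hsum
  rw [Finset.mem_range] at hi
  have hiN : i * N + N ≤ m := by
    calc i * N + N = (i + 1) * N := by ring
      _ ≤ j * N := by gcongr; omega
      _ ≤ m := hm
  refine ⟨fun t => s (i * N + t), fun t => u (i * N + t),
    ⟨fun t ht => h.1 (i * N + t) (by omega), fun t ht => h.2 (i * N + t) (by omega)⟩, ?_⟩
  simpa [add_mul] using hle

variable [DecidableEq V]

/-- The welfare strictly increases, so no profile is repeated. -/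
theorem IsImproving.lt_card {s : ℕ → Profile V k} {u : ℕ → V} {m : ℕ}
    (h : IsImproving A s u m) : m < k ^ Fintype.card V := by
  have : (Finset.range (m + 1)).card ≤ (Finset.univ : Finset (Profile V k)).card := by
    refine Finset.card_le_card_of_injOn s (fun _ _ => by simp) ?_
    intro t ht t' ht' heq
    simp only [Finset.coe_range, Set.mem_Iio] at ht ht'
    rcases lt_trichotomy t t' with hlt | hlt | hlt
    · exact absurd (congrArg (welfare A) heq) (h.welfare_lt hlt (by omega)).ne
    · exact hlt
    · exact absurd (congrArg (welfare A) heq) (h.welfare_lt hlt (by omega)).ne'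
  rw [Finset.card_range, Finset.card_univ, Fintype.card_fun, Fintype.card_fin] at this
  exact this

theorem IsExecution.exists_isImproving [Nonempty V] {σ₀ : Profile V k} {s : ℕ → Profile V k}
    (h : IsExecution A σ₀ s) {m : ℕ} (hm : ∀ t < m, ¬ IsPNE A (s t)) :
    ∃ u, IsImproving A s u m := by
  have hex : ∀ t, ∃ v, t < m → (s (t + 1) v ≠ s t v ∧ ∀ v', v' ≠ v → s (t + 1) v' = s t v') ∧
      payoff A v (s t) < payoff A v (s (t + 1)) := by
    intro t
    by_cases ht : t < m
    · obtain ⟨v, i, heq, hlt⟩ := h.move t (hm t ht)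
      refine ⟨v, fun _ => ⟨⟨fun hsame => ?_, fun v' hv' => ?_⟩, hlt⟩⟩
      · have hi : i = s t v := by
          rw [← hsame, heq, Function.update_self]
        rw [heq, hi, Function.update_eq_self] at hlt
        exact lt_irrefl _ hlt
      · rw [heq, Function.update_of_ne hv']
    · exact ⟨Classical.arbitrary V, fun h => absurd h ht⟩
  choose u hu using hex
  exact ⟨u, fun t ht => (hu t ht).1, fun t ht => (hu t ht).2⟩

/-- Every execution reaches an equilibrium, by improving moves only. -/
theorem IsExecution.stepsToPNE_le [Nonempty V] {σ₀ : Profile V k} {s : ℕ → Profile V k}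
    (h : IsExecution A σ₀ s) : ∃ m u, stepsToPNE A s ≤ (m : ℕ) ∧ IsImproving A s u m := by
  classical
  have hex : ∃ t, IsPNE A (s t) := by
    by_contra! hcon
    obtain ⟨u, hu⟩ := h.exists_isImproving (m := k ^ Fintype.card V) fun t _ => hcon t
    exact lt_irrefl _ hu.lt_card
  obtain ⟨u, hu⟩ := h.exists_isImproving (m := Nat.find hex) fun t ht => Nat.find_min hex ht
  exact ⟨Nat.find hex, u,
    iInf₂_le (f := fun t (_ : IsPNE A (s t)) => (t : ℕ∞)) _ (Nat.find_spec hex), hu⟩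

open Classical in
/-- The length of an improving sequence in terms of the number of scales at which the payoffs allow
slow improvement; the range of scales suffices because there are only `k ^ n` profiles. -/
theorem IsImproving.length_le (hA : ∀ e, A e ∈ Set.Icc (-1 : ℝ) 1) {s : ℕ → Profile V k}
    {u : ℕ → V} {m N : ℕ} (h : IsImproving A s u m) (hN : 1 ≤ N) :
    (m : ℝ≥0∞) ≤ N * (1 + ∑ j ∈ Finset.Icc 1 (k ^ Fintype.card V),
      if A ∈ slowPayoffs G k N ((Fintype.card V : ℝ) ^ 2 / j) then 1 else 0) := by
  have hm : m < N * (m / N + 1) := Nat.lt_mul_div_succ m hN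
  have hq : m / N ≤ k ^ Fintype.card V := (Nat.div_le_self _ _).trans h.lt_card.le
  calc (m : ℝ≥0∞) ≤ ((N * (m / N + 1) : ℕ) : ℝ≥0∞) := by exact_mod_cast hm.le
    _ = N * (1 + ∑ j ∈ Finset.Icc 1 (m / N), 1) := by
        push_cast
        simp [add_comm]
    _ = N * (1 + ∑ j ∈ Finset.Icc 1 (m / N),
          if A ∈ slowPayoffs G k N ((Fintype.card V : ℝ) ^ 2 / j) then 1 else 0) := by
        congr 2
        refine Finset.sum_congr rfl fun j hj => ?_
        rw [Finset.mem_Icc] at hj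
        rw [if_pos (h.mem_slowPayoffs hA hj.1 ?_)]
        exact (Nat.mul_le_mul_right N hj.2).trans (Nat.div_mul_le_self m N)
    _ ≤ _ := by
        gcongr

theorem brTime_le [Nonempty V] {c : ℝ≥0∞}
    (hc : ∀ (s : ℕ → Profile V k) (u : ℕ → V) (m : ℕ), IsImproving A s u m → (m : ℝ≥0∞) ≤ c) :
    ⨆ σ₀ : Profile V k, (brTime A σ₀ : ℝ≥0∞) ≤ c := by
  refine iSup_le fun σ₀ => ?_
  have hall : ∀ s, IsExecution A σ₀ s → ∃ m : ℕ, (m : ℝ≥0∞) ≤ c ∧ stepsToPNE A s ≤ m := by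
    intro s hs
    obtain ⟨m, u, hm, hu⟩ := hs.stepsToPNE_le
    exact ⟨m, hc s u m hu, hm⟩
  rw [brTime]
  simp only [ENat.toENNReal_iSup]
  refine iSup₂_le fun s hs => ?_
  obtain ⟨m, hm, hle⟩ := hall s hs
  exact (ENat.toENNReal_le.2 hle).trans (by simpa using hm)

/-- The dynamics is already at rest if there is only one strategy or there are no edges. -/
theorem brTime_eq_zero (h : k ≤ 1 ∨ G = ⊥) (σ₀ : Profile V k) : brTime A σ₀ = 0 := by
  have hpne : ∀ σ, IsPNE A σ := by
    intro σ v i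
    rcases h with hk | rfl
    · have : Subsingleton (Fin k) := Fin.subsingleton_iff_le_one.2 hk
      rw [Subsingleton.elim i (σ v), Function.update_eq_self]
    · have : IsEmpty ((⊥ : SimpleGraph V).neighborSet v) := ⟨fun w => w.2⟩
      simp [payoff]
  refine le_antisymm (iSup₂_le fun s _ => ?_) zero_le
  exact iInf₂_le 0 (hpne (s 0))

end Dynamics

/-! ### The expected number of steps -/

section Expectation

variable {V : Type*} [Fintype V] [DecidableEq V] {G : SimpleGraph V} [DecidableRel G.Adj] {k : ℕ}
  {Ω : Type*} [MeasurableSpace Ω] {P : Measure Ω} {φ : ℝ≥0} {A : PayoffIndex G k → Ω → ℝ}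

theorem expectedBRTime_eq_zero (h : k ≤ 1 ∨ G = ⊥) : expectedBRTime P A = 0 := by
  simp [expectedBRTime, brTime_eq_zero h]

variable [IsProbabilityMeasure P]

theorem expectedBRTime_le_card [Nonempty V] :
    expectedBRTime P A ≤ ENNReal.ofReal ((k : ℝ) ^ Fintype.card V) := by
  have : ∀ ω, ⨆ σ₀ : Profile V k, (brTime (fun e => A e ω) σ₀ : ℝ≥0∞) ≤
      ENNReal.ofReal ((k : ℝ) ^ Fintype.card V) := by
    refine fun ω => brTime_le fun s u m h => ?_
    rw [← Nat.cast_pow, ENNReal.ofReal_natCast]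
    exact_mod_cast h.lt_card.le
  calc expectedBRTime P A ≤ ∫⁻ _, ENNReal.ofReal ((k : ℝ) ^ Fintype.card V) ∂P :=
        lintegral_mono this
    _ = _ := by simp

/-- Summing the tail bounds for `1, …, k ^ n` stretches of `N` moves costs only a harmonic sum. -/
theorem expectedBRTime_le [Nonempty V] (hA : IsSmoothed P φ A) {N D : ℕ} (hN : 1 ≤ N) (hk : 1 ≤ k)
    (hblock : ∀ (A : PayoffIndex G k → ℝ) s u, IsImproving A s u N → HasEchelonBlock G s u N D) :
    expectedBRTime P A ≤ ENNReal.ofReal (N * (1 + N * ((Fintype.card V * k ^ 2 : ℝ) ^ D * φ *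
      Fintype.card V ^ 2) * (1 + Fintype.card V * Real.log k))) := by
  classical
  set n := Fintype.card V with hn
  set J := k ^ n with hJ
  set S : ℕ → Set Ω := fun j => {ω | (fun e => A e ω) ∈ slowPayoffs G k N ((n : ℝ) ^ 2 / j)} with hS
  have hfin : Finite (PayoffIndex G k) := inferInstance
  have hae : ∀ᵐ ω ∂P, ∀ e, A e ω ∈ Set.Icc (-1 : ℝ) 1 := ae_all_iff.2 hA.mem_Icc
  have hpt : ∀ᵐ ω ∂P, ⨆ σ₀ : Profile V k, (brTime (fun e => A e ω) σ₀ : ℝ≥0∞) ≤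
      N * (1 + ∑ j ∈ Finset.Icc 1 J, (toMeasurable P (S j)).indicator 1 ω) := by
    filter_upwards [hae] with ω hω
    refine brTime_le fun s u m h => (h.length_le hω hN).trans ?_
    gcongr with j hj
    split_ifs with hslow
    · rw [Set.indicator_of_mem (subset_toMeasurable P (S j) hslow)]
      rfl
    · exact zero_le
  have hprob : ∀ j, P (S j) ≤
      ENNReal.ofReal (N * ((n * k ^ 2 : ℝ) ^ D * φ * n ^ 2) * (j : ℝ)⁻¹) := by
    intro j
    refine (prob_slowPayoffs_le hA hN hk _ hblock).trans (le_of_eq ?_)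
    rw [← ENNReal.ofReal_natCast (n * k ^ 2), ← ENNReal.ofReal_natCast N,
      ← ENNReal.ofReal_pow (by positivity), ← ENNReal.ofReal_coe_nnreal,
      ← ENNReal.ofReal_mul (by positivity), ← ENNReal.ofReal_mul (by positivity),
      ← ENNReal.ofReal_mul (by positivity)]
    push_cast
    congr 1
    ring
  have hharm : ∑ j ∈ Finset.Icc 1 J, (j : ℝ)⁻¹ ≤ 1 + n * Real.log k := by
    have := harmonic_le_one_add_log J
    rw [harmonic_eq_sum_Icc] at this
    push_cast at this
    rwa [hJ, Nat.cast_pow, Real.log_pow, ← hJ] at this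
  calc expectedBRTime P A
      ≤ ∫⁻ ω, N * (1 + ∑ j ∈ Finset.Icc 1 J, (toMeasurable P (S j)).indicator 1 ω) ∂P :=
        lintegral_mono_ae hpt
    _ = N * (1 + ∑ j ∈ Finset.Icc 1 J, P (S j)) := by
        have hm : ∀ j, Measurable ((toMeasurable P (S j)).indicator (1 : Ω → ℝ≥0∞)) :=
          fun j => measurable_one.indicator (measurableSet_toMeasurable _ _)
        rw [lintegral_const_mul _ (by fun_prop), lintegral_add_left measurable_const,
          lintegral_finsetSum _ fun j _ => hm j]
        simp [lintegral_indicator_one (measurableSet_toMeasurable _ _), measure_toMeasurable]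
    _ ≤ N * (1 + ∑ j ∈ Finset.Icc 1 J,
          ENNReal.ofReal (N * ((n * k ^ 2 : ℝ) ^ D * φ * n ^ 2) * (j : ℝ)⁻¹)) := by
        gcongr with j hj
        exact hprob j
    _ = ENNReal.ofReal (N * (1 + N * ((n * k ^ 2 : ℝ) ^ D * φ * n ^ 2) *
          ∑ j ∈ Finset.Icc 1 J, (j : ℝ)⁻¹)) := by
        rw [← ENNReal.ofReal_sum_of_nonneg (fun j _ => by positivity), ← ENNReal.ofReal_one,
          ← ENNReal.ofReal_add zero_le_one (by positivity), ← ENNReal.ofReal_natCast N,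
          ← ENNReal.ofReal_mul (by positivity), ← Finset.mul_sum]
    _ ≤ _ := by
        refine ENNReal.ofReal_le_ofReal ?_
        gcongr

/-- A clean form of the bound, for blocks of length `O(n k)`. -/
theorem expectedBRTime_le_pow [Nonempty V] (hA : IsSmoothed P φ A) {N D : ℕ} (hN : 1 ≤ N)
    (hNX : N ≤ 4 * (k * Fintype.card V)) (hk : 2 ≤ k) (hV : 2 ≤ Fintype.card V) (hφ : 1 ≤ 2 * φ)
    (hblock : ∀ (A : PayoffIndex G k → ℝ) s u, IsImproving A s u N → HasEchelonBlock G s u N D) :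
    expectedBRTime P A ≤ ENNReal.ofReal (φ * (Fintype.card V * k : ℝ) ^ (2 * D + 9)) := by
  refine (expectedBRTime_le hA hN (by omega) hblock).trans (ENNReal.ofReal_le_ofReal ?_)
  set n : ℝ := (Fintype.card V : ℝ) with hn
  have hn2 : (2 : ℝ) ≤ n := by
    rw [hn]
    exact_mod_cast hV
  have hk2 : (2 : ℝ) ≤ k := by exact_mod_cast hk
  have hφ2 : (1 : ℝ) ≤ 2 * φ := by exact_mod_cast hφ
  have hNr : (N : ℝ) ≤ 4 * (n * k) := by
    rw [hn, mul_comm (Fintype.card V : ℝ)]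
    exact_mod_cast hNX
  set X : ℝ := n * k with hX
  have hX4 : 4 ≤ X := by nlinarith
  have hnX : n ≤ X := by nlinarith
  have hB : n * (k : ℝ) ^ 2 ≤ X ^ 2 := by
    rw [hX]
    nlinarith [sq_nonneg (k : ℝ), mul_nonneg (sq_nonneg (k : ℝ)) (by linarith : (0 : ℝ) ≤ n)]
  have hlog : 1 + n * Real.log k ≤ 2 * X := by
    have := Real.log_le_sub_one_of_pos (show (0 : ℝ) < k by linarith)
    have : n * Real.log k ≤ n * k := by
      gcongr
      linarith
    linarith
  have hlog0 : 0 ≤ Real.log (k : ℝ) := Real.log_nonneg (by linarith)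
  have hX8 : 40 * X ^ 5 ≤ X ^ 9 := by
    have : (4 : ℝ) ^ 4 ≤ X ^ 4 := by gcongr
    calc 40 * X ^ 5 ≤ 4 ^ 4 * X ^ 5 := by
          gcongr
          norm_num
      _ ≤ X ^ 4 * X ^ 5 := by gcongr
      _ = X ^ 9 := by ring
  have hXD : (1 : ℝ) ≤ X ^ (2 * D) := one_le_pow₀ (by linarith)
  have hX5 : X ≤ X ^ 5 := le_self_pow₀ (by linarith) (by norm_num)
  calc (N : ℝ) * (1 + N * ((n * (k : ℝ) ^ 2) ^ D * φ * n ^ 2) * (1 + n * Real.log k))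
      ≤ 4 * X * (1 + 4 * X * ((X ^ 2) ^ D * φ * X ^ 2) * (2 * X)) := by gcongr
    _ = 4 * X + φ * X ^ (2 * D) * (32 * X ^ 5) := by
        rw [← pow_mul]
        ring
    _ ≤ φ * X ^ (2 * D) * (8 * X) + φ * X ^ (2 * D) * (32 * X ^ 5) := by
        have : 1 ≤ 2 * (φ * X ^ (2 * D)) := by nlinarith
        have : 4 * X * 1 ≤ 4 * X * (2 * (φ * X ^ (2 * D))) := by gcongr
        linarith
    _ ≤ φ * X ^ (2 * D) * (8 * X ^ 5) + φ * X ^ (2 * D) * (32 * X ^ 5) := by gcongr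
    _ = φ * X ^ (2 * D) * (40 * X ^ 5) := by ring
    _ ≤ φ * X ^ (2 * D) * X ^ 9 := by gcongr
    _ = φ * X ^ (2 * D + 9) := by ring

end Expectation

/-! ### The two bounds -/

section Numeric

/-- With `Y ≥ 4` and `φ ≥ 1 / 2` a power of `Y` is absorbed by a power of `Y φ`, as `(Y φ) ^ 2 ≥ Y`. -/
theorem mul_pow_le_mul_pow {Y φ : ℝ} (hY : 4 ≤ Y) (hφ : 1 ≤ 2 * φ) {m M : ℕ} (hM : 2 * m + 1 ≤ M) :
    φ * Y ^ m ≤ (Y * φ) ^ M := by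
  have h1 : Y ≤ (Y * φ) ^ 2 := by
    have h2 : 1 ≤ (2 * φ) ^ 2 := one_le_pow₀ hφ
    calc Y = Y * 1 := (mul_one Y).symm
      _ ≤ Y * (2 * φ) ^ 2 := by gcongr
      _ = 4 * (Y * φ ^ 2) := by ring
      _ ≤ Y * (Y * φ ^ 2) := by gcongr
      _ = (Y * φ) ^ 2 := by ring
  have h3 : φ ≤ Y * φ := by nlinarith
  have h4 : 1 ≤ Y * φ := by nlinarith
  calc φ * Y ^ m ≤ (Y * φ) * ((Y * φ) ^ 2) ^ m := by gcongr
    _ = (Y * φ) ^ (2 * m + 1) := by ring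
    _ ≤ (Y * φ) ^ M := pow_le_pow_right₀ h4 hM

/-- If there are more strategies than players, the number of profiles is polynomial in `n ^ k`. -/
theorem pow_card_le {n k : ℕ} (hn : 2 ≤ n) (hnk : n ≤ k) : k ^ n ≤ n ^ (2 * k) := by
  have h1 : k ≤ n * 2 ^ (k / n) := by
    have := Nat.lt_mul_div_succ k (by omega : 0 < n)
    refine this.le.trans ?_
    gcongr
    exact Nat.lt_two_pow_self
  calc k ^ n ≤ (n * 2 ^ (k / n)) ^ n := by gcongr
    _ = n ^ n * 2 ^ (k / n * n) := by rw [mul_pow, pow_mul]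
    _ ≤ n ^ k * n ^ k := by
      gcongr
      · omega
      · omega
      · exact Nat.div_mul_le_self k n
    _ = n ^ (2 * k) := by rw [two_mul, pow_add]

end Numeric

section Bounds

variable {V : Type*} [Fintype V] [DecidableEq V] {G : SimpleGraph V} [DecidableRel G.Adj] {k : ℕ}
  {Ω : Type*} [MeasurableSpace Ω] {P : Measure Ω} [IsProbabilityMeasure P] {φ : ℝ≥0}
  {A : PayoffIndex G k → Ω → ℝ}

/-- Complete game graphs: the blocks have `D = 32 k`. -/
theorem expectedBRTime_le_of_eq_top [Nonempty V] (hA : IsSmoothed P φ A) (hG : G = ⊤) (hk : 2 ≤ k)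
    (hV : 2 ≤ Fintype.card V) (hφ : 1 ≤ 2 * φ) :
    expectedBRTime P A ≤ ENNReal.ofReal (φ * (Fintype.card V * k : ℝ) ^ (69 * k)) := by
  have hpos : 0 < 2 * (k * Fintype.card V) := by positivity
  refine (expectedBRTime_le_pow hA hpos (by omega) hk hV hφ fun A s u hs =>
    hs.hasEchelonBlock_of_eq_top hG rfl hpos).trans (ENNReal.ofReal_le_ofReal ?_)
  gcongr
  · have h1 : (1 : ℝ) ≤ Fintype.card V := by exact_mod_cast (by omega : 1 ≤ Fintype.card V)
    have h2 : (1 : ℝ) ≤ k := by exact_mod_cast (by omega : 1 ≤ k)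
    nlinarith
  · omega

/-- Arbitrary game graphs: the blocks have `D = 4 h k`, where `2 ^ h` is the least power of two above
`2 n k`. -/
theorem expectedBRTime_le_rpow [Nonempty V] (hA : IsSmoothed P φ A) (hk : 2 ≤ k)
    (hV : 2 ≤ Fintype.card V) (hφ : 1 ≤ 2 * φ) :
    expectedBRTime P A ≤ ENNReal.ofReal (φ * (Fintype.card V * k : ℝ) ^
      (28 * k * Real.log (Fintype.card V * k) : ℝ)) := by
  set x := k * Fintype.card V with hx
  have hx4 : 4 ≤ x := by nlinarith
  set h := Nat.log 2 (2 * x) + 1 with hh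
  have hlow : 2 * x < 2 ^ h := Nat.lt_pow_succ_log_self (by norm_num) _
  have hup : 2 ^ (h - 1) ≤ 2 * x := Nat.pow_log_le_self 2 (by omega)
  have hup' : 2 ^ h ≤ 4 * x := by
    rw [hh, pow_succ]
    rw [hh, Nat.add_sub_cancel] at hup
    omega
  refine (expectedBRTime_le_pow hA Nat.one_le_two_pow hup' hk hV hφ fun A s u hs =>
    hs.hasEchelonBlock rfl hlow).trans (ENNReal.ofReal_le_ofReal ?_)
  have hX : (Fintype.card V * k : ℝ) = (x : ℝ) := by
    rw [hx]
    push_cast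
    ring
  rw [hX]
  have hx4' : (4 : ℝ) ≤ x := by exact_mod_cast hx4
  have hk2 : (2 : ℝ) ≤ k := by exact_mod_cast hk
  have hlog2 := Real.log_two_gt_d9
  have hlogx : 2 * Real.log 2 ≤ Real.log x := by
    have : Real.log (2 ^ 2) ≤ Real.log x := Real.log_le_log (by norm_num) (by linarith)
    rwa [Real.log_pow] at this
  have hhlog : (h : ℝ) * Real.log 2 ≤ 2 * Real.log 2 + Real.log x := by
    have h1 : Real.log ((2 ^ h : ℕ) : ℝ) ≤ Real.log ((4 * x : ℕ) : ℝ) :=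
      Real.log_le_log (by positivity) (by exact_mod_cast hup')
    push_cast at h1
    rw [Real.log_pow, Real.log_mul (by norm_num) (by linarith)] at h1
    have h2 : Real.log 4 = 2 * Real.log 2 := by
      rw [show (4 : ℝ) = 2 ^ 2 by norm_num, Real.log_pow]
      norm_num
    linarith
  have hh3 : (h : ℝ) ≤ 3 * Real.log x := by nlinarith
  have hexp : ((2 * (4 * h * k) + 9 : ℕ) : ℝ) ≤ 28 * k * Real.log x := by
    push_cast
    have h1 : (k : ℝ) * h ≤ k * (3 * Real.log x) := by gcongr
    have h2 : 2 * (2 * 0.69) ≤ (k : ℝ) * Real.log x := by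
      gcongr
      linarith
    nlinarith
  rw [← Real.rpow_natCast]
  gcongr
  linarith

end Bounds

end NetCoord

theorem mainTheorem3 :
    ∃ C : ℕ, ∀ (V : Type*) [Fintype V] [DecidableEq V] (G : SimpleGraph V) [DecidableRel G.Adj]
      (n k : ℕ) (φ : ℝ≥0) (Ω : Type*) [MeasurableSpace Ω] (P : Measure Ω) [IsProbabilityMeasure P]
      (A : NetCoord.PayoffIndex G k → Ω → ℝ),
      Fintype.card V = n → NetCoord.IsSmoothed P φ A →
      -- arbitrary game graphs: `O(φ) (nk)^{O(k log(nk))}`, polynomial in `(n^{k log(nk)}, φ)`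
      (NetCoord.expectedBRTime P A ≤
          ENNReal.ofReal (C * φ * ((n * k : ℝ) ^ (C * k * Real.log (n * k) : ℝ))) ∧
        NetCoord.expectedBRTime P A ≤
          ENNReal.ofReal (C * ((n : ℝ) ^ (k * Real.log (n * k) : ℝ) * φ) ^ C)) ∧
      -- complete game graphs: `(nkφ)^{O(k)}`, polynomial in `(n^k, φ)`
      (G = ⊤ →
        NetCoord.expectedBRTime P A ≤ ENNReal.ofReal ((n * k * φ : ℝ) ^ (C * k)) ∧
        NetCoord.expectedBRTime P A ≤ ENNReal.ofReal (C * ((n : ℝ) ^ k * φ) ^ C)) := by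
  refine ⟨300, ?_⟩
  intro V _ _ G _ n k φ Ω _ P _ A hn hA
  by_cases hdeg : k ≤ 1 ∨ G = ⊥
  · simp [NetCoord.expectedBRTime_eq_zero hdeg]
  push Not at hdeg
  obtain ⟨hk, hG⟩ := hdeg
  have hk : 2 ≤ k := hk
  obtain ⟨a, b, hab⟩ := SimpleGraph.ne_bot_iff_exists_adj.1 hG
  have hnonempty : Nonempty V := ⟨a⟩
  have hV : 2 ≤ Fintype.card V := Fintype.one_lt_card_iff.2 ⟨a, b, G.ne_of_adj hab⟩
  have hφ : 1 ≤ 2 * φ := hA.one_le_two_mul ⟨s((a, ⟨0, by omega⟩), (b, ⟨0, by omega⟩)), hab⟩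
  have hφ' : (1 : ℝ) ≤ 2 * φ := by exact_mod_cast hφ
  have hgen := NetCoord.expectedBRTime_le_rpow hA hk hV hφ
  have hcard := NetCoord.expectedBRTime_le_card (P := P) (A := A)
  rw [hn] at hgen hcard hV
  have hn2 : (2 : ℝ) ≤ n := by exact_mod_cast hV
  have hk2 : (2 : ℝ) ≤ k := by exact_mod_cast hk
  have hX4 : (4 : ℝ) ≤ n * k := by nlinarith
  have hlog1 : 1 ≤ Real.log (n * k) := by
    have h1 : Real.log (2 ^ 2) ≤ Real.log (n * k) := Real.log_le_log (by norm_num) (by linarith)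
    rw [Real.log_pow] at h1
    have := Real.log_two_gt_d9
    push_cast at h1
    linarith
  -- `n ^ k` is at least `4` and at most `n ^ (k log (n k))`
  have hY4 : (4 : ℝ) ≤ (n : ℝ) ^ k := by
    calc (4 : ℝ) = 2 ^ 2 := by norm_num
      _ ≤ (n : ℝ) ^ 2 := by gcongr
      _ ≤ (n : ℝ) ^ k := pow_le_pow_right₀ (by linarith) hk
  have hYY : (n : ℝ) ^ k ≤ (n : ℝ) ^ (k * Real.log (n * k) : ℝ) := by
    rw [← Real.rpow_natCast]
    gcongr
    · linarith
    · nlinarith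
  -- for `k > n` the number of profiles is small enough
  have hmany : n < k → ∀ Y : ℝ, (n : ℝ) ^ k ≤ Y → NetCoord.expectedBRTime P A ≤
      ENNReal.ofReal ((300 : ℕ) * (Y * φ) ^ 300) := by
    intro hnk Y hY
    refine hcard.trans (ENNReal.ofReal_le_ofReal ?_)
    have hk0 : (k : ℝ) ^ n ≤ (n : ℝ) ^ (2 * k) := by exact_mod_cast NetCoord.pow_card_le hV hnk.le
    have h1 := NetCoord.mul_pow_le_mul_pow (m := 2) (M := 300) (hY4.trans hY) hφ' (by norm_num)
    calc (k : ℝ) ^ n ≤ ((n : ℝ) ^ k) ^ 2 := by rwa [← pow_mul, mul_comm k]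
      _ ≤ Y ^ 2 := by gcongr
      _ ≤ 2 * φ * Y ^ 2 := le_mul_of_one_le_left (by positivity) hφ'
      _ ≤ (300 : ℕ) * (Y * φ) ^ 300 := by
        push_cast
        nlinarith [sq_nonneg Y]
  have hsquare : k ≤ n → (n * k : ℝ) ≤ (n : ℝ) ^ 2 := by
    intro hkn
    have : (k : ℝ) ≤ n := by exact_mod_cast hkn
    nlinarith
  refine ⟨⟨?_, ?_⟩, fun hG => ⟨?_, ?_⟩⟩
  · refine hgen.trans (ENNReal.ofReal_le_ofReal ?_)
    push_cast
    have h1 : (n * k : ℝ) ^ (28 * k * Real.log (n * k) : ℝ) ≤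
        (n * k : ℝ) ^ (300 * k * Real.log (n * k) : ℝ) := by
      gcongr
      · linarith
      · norm_num
    calc (φ : ℝ) * (n * k : ℝ) ^ (28 * k * Real.log (n * k) : ℝ)
        ≤ φ * (n * k : ℝ) ^ (300 * k * Real.log (n * k) : ℝ) := by gcongr
      _ ≤ 300 * φ * (n * k : ℝ) ^ (300 * k * Real.log (n * k) : ℝ) := by
        gcongr
        nlinarith
  · rcases lt_or_ge n k with hnk | hkn
    · exact hmany hnk _ hYY
    · refine hgen.trans (ENNReal.ofReal_le_ofReal ?_)
      have h1 := NetCoord.mul_pow_le_mul_pow (m := 56) (M := 300) (hY4.trans hYY) hφ' (by norm_num)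
      have h2 : (n * k : ℝ) ^ (28 * k * Real.log (n * k) : ℝ) ≤
          ((n : ℝ) ^ (k * Real.log (n * k) : ℝ)) ^ 56 := by
        calc (n * k : ℝ) ^ (28 * k * Real.log (n * k) : ℝ)
            ≤ ((n : ℝ) ^ 2) ^ (28 * k * Real.log (n * k) : ℝ) := by
              gcongr
              exact hsquare hkn
          _ = _ := by
              rw [← Real.rpow_natCast, ← Real.rpow_natCast, ← Real.rpow_mul (by linarith),
                ← Real.rpow_mul (by linarith)]
              congr 1
              push_cast
              ring
      calc (φ : ℝ) * (n * k : ℝ) ^ (28 * k * Real.log (n * k) : ℝ)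
          ≤ φ * ((n : ℝ) ^ (k * Real.log (n * k) : ℝ)) ^ 56 := by gcongr
        _ ≤ ((n : ℝ) ^ (k * Real.log (n * k) : ℝ) * φ) ^ 300 := h1
        _ ≤ (300 : ℕ) * ((n : ℝ) ^ (k * Real.log (n * k) : ℝ) * φ) ^ 300 := by
            have h3 : 0 ≤ ((n : ℝ) ^ (k * Real.log (n * k) : ℝ) * φ) ^ 300 :=
              pow_nonneg (by positivity) _
            rw [Nat.cast_ofNat]
            linarith
  · have htop := NetCoord.expectedBRTime_le_of_eq_top hA hG hk (hn ▸ hV) hφ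
    rw [hn] at htop
    refine htop.trans (ENNReal.ofReal_le_ofReal ?_)
    exact NetCoord.mul_pow_le_mul_pow hX4 hφ' (by omega)
  · rcases lt_or_ge n k with hnk | hkn
    · exact hmany hnk _ le_rfl
    · have htop := NetCoord.expectedBRTime_le_of_eq_top hA hG hk (hn ▸ hV) hφ
      rw [hn] at htop
      refine htop.trans (ENNReal.ofReal_le_ofReal ?_)
      have h1 := NetCoord.mul_pow_le_mul_pow (m := 138) (M := 300) hY4 hφ' (by norm_num)
      calc (φ : ℝ) * (n * k : ℝ) ^ (69 * k) ≤ φ * ((n : ℝ) ^ 2) ^ (69 * k) := by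
            gcongr
            exact hsquare hkn
        _ = φ * ((n : ℝ) ^ k) ^ 138 := by
            rw [← pow_mul, ← pow_mul]
            congr 2
            omega
        _ ≤ ((n : ℝ) ^ k * φ) ^ 300 := h1
        _ ≤ (300 : ℕ) * ((n : ℝ) ^ k * φ) ^ 300 := by
            have h2 : 0 ≤ ((n : ℝ) ^ k * φ) ^ 300 := pow_nonneg (by positivity) _
            rw [Nat.cast_ofNat]
            linarith
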